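/- Let $\mathcal R$ be an o-minimal expansion of the ordered field of real numbers; "definable" means definable in $\mathcal R$ with real parameters, and $\mathbb C^k$ is identified with $\mathbb R^{2k}$. For an open definable set $\Omega\subset\mathbb R^k$ let $\mathcal A(\Omega)$ be the set of $\mathbb C$-definable functions on $\Omega$, i.e. of the functions $f:\Omega\to\mathbb R$ for which there are an open definable set $\tilde\Omega\subset\mathbb C^k$ with $\tilde\Omega\cap\mathbb R^k=\Omega$ and a definable holomorphic function $\tilde f:\tilde\Omega\to\mathbb C$ with $\tilde f|_\Omega=f$ (such $f$ are real analytic and definable). **Theorem 4.1.** Let $n\ge 1$, $p\ge 0$, write $x=(x',x_n)$ for the points of $\mathbb R^n$, $t=(t_1,\dots,t_p)$ for those of $\mathbb R^p$, and let $P(t,x_n)=x_n^p+\sum_{j=1}^p t_jx_n^{p-j}$ be the generic monic polynomial of degree $p$. Let $\pi(x',x_n,t)=(x',t)$ and $\sigma(b)=(-\sigma_1(b),\dots,(-1)^p\sigma_p(b))$ for $b\in\mathbb R^p$, where $\sigma_j$ is the $j$-th elementary symmetric function. Let $\Omega\subset\mathbb R^n$ be open and definable and let $g\in\mathcal A(\Omega)$.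 Then there are an open definable set $W\subset\Omega\times\mathbb R^p$, a function $q\in\mathcal A(W)$ and functions $h_j\in\mathcal A(\pi(W))$, $1\le j\le p$, such that $$g(x)=q(x,t)\,P(t,x_n)+\sum_{j=1}^p h_j(x',t)\,x_n^{p-j}\qquad\text{for all }(x,t)\in W.$$ Moreover, $W$ can be chosen so that its projection to $\mathbb R^n$ is $\Omega$ and so that $(x,\sigma(b))\in W$ whenever $x=(x',x_n)\in\Omega$ and $b=(b_1,\dots,b_p)\in\mathbb R^p$ satisfy $(x',b_j)\in\Omega$ for $1\le j\le p$; in particular $(x,\sigma(x_n,\dots,x_n))\in W$ for all $x\in\Omega$. -/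

import Mathlib

universe u v

section OMinimal

variable (L : FirstOrder.Language.{u, v}) [L.Structure ℝ]

/-- `Z ⊆ ℝ^α` is definable in the structure `ℝ`, with arbitrary real parameters. -/
def DefinableSet {α : Type*} (Z : Set (α → ℝ)) : Prop :=
  (Set.univ : Set ℝ).Definable L Z

/-- `f : Z → ℝ`, for `Z ⊆ ℝ^α`, is definable: its graph is a definable subset of `ℝ^α × ℝ`. Only
the values of `f` on `Z` matter. -/
def DefinableFunOn {α : Type*} (Z : Set (α → ℝ)) (f : (α → ℝ) → ℝ) : Prop :=
  DefinableSet L {w : Option α → ℝ | w ∘ some ∈ Z ∧ f (w ∘ some) = w none}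

/-- The `L`-structure on `ℝ` is an o-minimal expansion of the ordered field of real numbers: order,
addition and multiplication are definable, and each definable `Z ⊆ ℝ` is a finite union of points
and open intervals with endpoints in `[-∞, ∞]`. -/
structure IsOMinimalExpansion : Prop where
  definable_lt : (Set.univ : Set ℝ).Definable₂ L {a : ℝ × ℝ | a.1 < a.2}
  definable_add : (Set.univ : Set ℝ).DefinableFun L (fun a : Fin 2 → ℝ => a 0 + a 1)
  definable_mul : (Set.univ : Set ℝ).DefinableFun L (fun a : Fin 2 → ℝ => a 0 * a 1)
  ominimal : ∀ Z : Set ℝ, (Set.univ : Set ℝ).Definable₁ L Z →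
    ∃ 𝓘 : Set (Set ℝ), 𝓘.Finite ∧ Z = ⋃₀ 𝓘 ∧
      ∀ I ∈ 𝓘, (∃ a : ℝ, I = {a}) ∨ ∃ a b : EReal, I = {r : ℝ | a < (r : EReal) ∧ (r : EReal) < b}

end OMinimal

section CDefinable

/-- The identification of `ℝ^ι × ℝ^ι` with `ℂ^ι`, `(x, y) ↦ x + i y`. -/
def toComplex {ι : Type*} (w : ι ⊕ ι → ℝ) : ι → ℂ :=
  fun k => ⟨w (Sum.inl k), w (Sum.inr k)⟩

variable (L : FirstOrder.Language.{u, v}) [L.Structure ℝ]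

/-- `Z ⊆ ℂ^ι` is definable when it is so as a subset of `ℝ^ι × ℝ^ι`. -/
def DefinableComplexSet {ι : Type*} (Z : Set (ι → ℂ)) : Prop :=
  DefinableSet L (toComplex ⁻¹' Z)

/-- `f : Z → ℂ`, for `Z ⊆ ℂ^ι`, is definable when its real and imaginary parts are so. -/
def DefinableComplexFunOn {ι : Type*} (Z : Set (ι → ℂ)) (f : (ι → ℂ) → ℂ) : Prop :=
  DefinableFunOn L (toComplex ⁻¹' Z) (fun w => (f (toComplex w)).re) ∧
  DefinableFunOn L (toComplex ⁻¹' Z) (fun w => (f (toComplex w)).im)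

/-- `f ∈ 𝒜(Ω)`, for `Ω ⊆ ℝ^ι` open and definable: the function `f : Ω → ℝ` is `ℂ`-definable, that
is, it extends to a definable holomorphic function `F` on an open definable `Ω' ⊆ ℂ^ι` with
`Ω' ∩ ℝ^ι = Ω`. Such an `f` is automatically real analytic and definable on `Ω`. Only the values
of `f` on `Ω` matter. -/
def CDefinableOn {ι : Type*} [Fintype ι] (Ω : Set (ι → ℝ)) (f : (ι → ℝ) → ℝ) : Prop :=
  ∃ (Ω' : Set (ι → ℂ)) (F : (ι → ℂ) → ℂ),
    IsOpen Ω' ∧ DefinableComplexSet L Ω' ∧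
    (∀ x : ι → ℝ, (fun k => (x k : ℂ)) ∈ Ω' ↔ x ∈ Ω) ∧
    DifferentiableOn ℂ F Ω' ∧ DefinableComplexFunOn L Ω' F ∧
    ∀ x ∈ Ω, F (fun k => (x k : ℂ)) = (f x : ℂ)

end CDefinable

/-- The generic monic polynomial `P(t, y) = y^p + ∑_{j=1}^p t_j y^{p-j}`; the coefficient `t_j` is
`t (j - 1)`. -/
def genericPoly {p : ℕ} (t : Fin p → ℝ) (y : ℝ) : ℝ :=
  y ^ p + ∑ j : Fin p, t j * y ^ (p - (j.val + 1))

/-- `σ(b) = (-σ_1(b), …, (-1)^p σ_p(b))`, with `σ_j` the elementary symmetric functions: the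
coefficients of the monic polynomial with roots `b_1, …, b_p`. -/
noncomputable def signedEsymm {p : ℕ} (b : Fin p → ℝ) : Fin p → ℝ :=
  fun j => (-1) ^ (j.val + 1) * MvPolynomial.eval b (MvPolynomial.esymm (Fin p) ℝ (j.val + 1))

/-- The projection `ℝ^n × ℝ^p → ℝ^n`, `(x, t) ↦ x`. -/
def projBase {n p : ℕ} (w : Fin n ⊕ Fin p → ℝ) : Fin n → ℝ :=
  w ∘ Sum.inl

/-- The projection `ℝ^{m+1} × ℝ^p → ℝ^m × ℝ^p`, `(x', x_{m+1}, t) ↦ (x', t)`. -/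
def projInit {m p : ℕ} (w : Fin (m + 1) ⊕ Fin p → ℝ) : Fin m ⊕ Fin p → ℝ :=
  w ∘ Sum.map Fin.castSucc id

/-!
Let `G` be a definable holomorphic extension of `g` to `Ω' ⊆ ℂ^n`. The division of `G(x', ·)` by
`P(t, ·)` is Hermite interpolation at the roots of `P(t, ·)`, so it makes sense whenever all the
complex roots `y` of `P(t, ·)` satisfy `(x', y) ∈ Ω'`, whether or not the fibre of `Ω'` over `x'`
is connected. These `(x', t)` form an open definable set (`remainderDomain`).

The remainder is pinned down by `IsRemainder`: `G(x', ·)` minus the remainder is `O(P(t, ·))` at each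
root. This determines the coefficients (`IsRemainder.unique`), and it is a first-order condition, so
the coefficients are definable functions of `(x', t)` (`definable_remainder`); no integral has to be
definable. They are holomorphic because locally they are Cauchy integrals over fixed small circles
around the roots (`exists_differentiableAt_isRemainder`), which depend holomorphically on the
parameters (`differentiableAt_circleIntegral`).

The quotient needs no separate theory: its value at `Y = s` is the leading coefficient of the
remainder modulo `(Y - s) P(t, Y)`, a polynomial with one more root (`IsRemainder.division`). Hence it
is the remainder in degree `p + 1` composed with a polynomial map, and inherits definability and
holomorphy.

Finally the real parts of the complex quotient and remainder are taken on the real points. The real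
part of a definable holomorphic `F` extends to `(F(z) + conj F(conj z)) / 2` (`cDefinableOn_re`), and
at real points the division identity passes to real parts because `P(t, x_n)` and the powers of `x_n`
are real.
-/

/-! ### Definable complex sets and functions -/

section Definability

variable {L : FirstOrder.Language.{u, v}} [L.Structure ℝ] {ι κ : Type*}

/-- A total function `f : ℂ^ι → ℂ` is definable when its real and imaginary parts are so. -/
def DefinableComplexFun (L : FirstOrder.Language.{u, v}) [L.Structure ℝ] {ι : Type*}
    (f : (ι → ℂ) → ℂ) : Prop :=
  (Set.univ : Set ℝ).DefinableFun L (fun w : ι ⊕ ι → ℝ => (f (toComplex w)).re) ∧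
  (Set.univ : Set ℝ).DefinableFun L (fun w : ι ⊕ ι → ℝ => (f (toComplex w)).im)

namespace IsOMinimalExpansion

theorem real_add (hL : IsOMinimalExpansion L) {f g : (ι → ℝ) → ℝ}
    (hf : (Set.univ : Set ℝ).DefinableFun L f) (hg : (Set.univ : Set ℝ).DefinableFun L g) :
    (Set.univ : Set ℝ).DefinableFun L (fun x => f x + g x) := by
  have : (Set.univ : Set ℝ).DefinableMap L (fun x => ![f x, g x]) := by
    intro i; fin_cases i <;> simpa
  simpa using! hL.definable_add.comp this

theorem real_mul (hL : IsOMinimalExpansion L) {f g : (ι → ℝ) → ℝ}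
    (hf : (Set.univ : Set ℝ).DefinableFun L f) (hg : (Set.univ : Set ℝ).DefinableFun L g) :
    (Set.univ : Set ℝ).DefinableFun L (fun x => f x * g x) := by
  have : (Set.univ : Set ℝ).DefinableMap L (fun x => ![f x, g x]) := by
    intro i; fin_cases i <;> simpa
  simpa using! hL.definable_mul.comp this

theorem real_const (c : ℝ) : (Set.univ : Set ℝ).DefinableFun L (fun _ : ι → ℝ => c) :=
  L.definableFun_const ι (Set.mem_univ c)

theorem real_neg (hL : IsOMinimalExpansion L) {f : (ι → ℝ) → ℝ}
    (hf : (Set.univ : Set ℝ).DefinableFun L f) :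
    (Set.univ : Set ℝ).DefinableFun L (fun x => -f x) := by
  simpa using! hL.real_mul (real_const (-1)) hf

theorem real_lt (hL : IsOMinimalExpansion L) {f g : (ι → ℝ) → ℝ}
    (hf : (Set.univ : Set ℝ).DefinableFun L f) (hg : (Set.univ : Set ℝ).DefinableFun L g) :
    (Set.univ : Set ℝ).Definable L {x | f x < g x} := by
  have : (Set.univ : Set ℝ).DefinableMap L (fun x => ![f x, g x]) := by
    intro i; fin_cases i <;> simpa
  simpa using! Set.Definable.preimage_map this hL.definable_lt

end IsOMinimalExpansion

namespace DefinableComplexFun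

theorem const (c : ℂ) : DefinableComplexFun L (fun _ : ι → ℂ => c) :=
  ⟨IsOMinimalExpansion.real_const _, IsOMinimalExpansion.real_const _⟩

theorem proj (i : ι) : DefinableComplexFun L (fun z : ι → ℂ => z i) :=
  ⟨Set.DefinableFun.proj L (i := Sum.inl i), Set.DefinableFun.proj L (i := Sum.inr i)⟩

theorem add (hL : IsOMinimalExpansion L) {f g : (ι → ℂ) → ℂ} (hf : DefinableComplexFun L f)
    (hg : DefinableComplexFun L g) : DefinableComplexFun L (fun z => f z + g z) :=
  ⟨hL.real_add hf.1 hg.1, hL.real_add hf.2 hg.2⟩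

theorem mul (hL : IsOMinimalExpansion L) {f g : (ι → ℂ) → ℂ} (hf : DefinableComplexFun L f)
    (hg : DefinableComplexFun L g) : DefinableComplexFun L (fun z => f z * g z) := by
  constructor
  · simpa [sub_eq_add_neg] using!
      hL.real_add (hL.real_mul hf.1 hg.1) (hL.real_neg (hL.real_mul hf.2 hg.2))
  · simpa using! hL.real_add (hL.real_mul hf.1 hg.2) (hL.real_mul hf.2 hg.1)

theorem sub (hL : IsOMinimalExpansion L) {f g : (ι → ℂ) → ℂ} (hf : DefinableComplexFun L f)
    (hg : DefinableComplexFun L g) : DefinableComplexFun L (fun z => f z - g z) := by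
  simpa [sub_eq_add_neg] using! hf.add hL ((const (-1)).mul hL hg)

theorem pow (hL : IsOMinimalExpansion L) {f : (ι → ℂ) → ℂ} (hf : DefinableComplexFun L f)
    (k : ℕ) : DefinableComplexFun L (fun z => f z ^ k) := by
  induction k with
  | zero => simpa using! const 1
  | succ k ih => simpa [pow_succ] using! ih.mul hL hf

theorem sum (hL : IsOMinimalExpansion L) {α : Type*} (s : Finset α) {f : α → (ι → ℂ) → ℂ}
    (hf : ∀ a, DefinableComplexFun L (f a)) :
    DefinableComplexFun L (fun z => ∑ a ∈ s, f a z) := by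
  classical
  induction s using Finset.induction_on with
  | empty => simpa using! const 0
  | insert a s ha ih => simpa [Finset.sum_insert ha] using! (hf a).add hL ih

theorem conj (hL : IsOMinimalExpansion L) {f : (ι → ℂ) → ℂ} (hf : DefinableComplexFun L f) :
    DefinableComplexFun L (fun z => (starRingEnd ℂ) (f z)) :=
  ⟨hf.1, hL.real_neg hf.2⟩

theorem definableMap {F : (κ → ℂ) → ι → ℂ} (hF : ∀ i, DefinableComplexFun L (fun z => F z i)) :
    (Set.univ : Set ℝ).DefinableMap L (fun w : κ ⊕ κ → ℝ =>
      Sum.elim (fun i => (F (toComplex w) i).re) (fun i => (F (toComplex w) i).im)) := by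
  rintro (i | i)
  exacts [(hF i).1, (hF i).2]

theorem comp [Finite ι] {f : (ι → ℂ) → ℂ} (hf : DefinableComplexFun L f)
    {F : (κ → ℂ) → ι → ℂ} (hF : ∀ i, DefinableComplexFun L (fun z => F z i)) :
    DefinableComplexFun L (fun z => f (F z)) :=
  ⟨hf.1.comp (definableMap hF), hf.2.comp (definableMap hF)⟩

end DefinableComplexFun

namespace DefinableComplexSet

theorem preimage [Finite ι] {Z : Set (ι → ℂ)} (hZ : DefinableComplexSet L Z)
    {F : (κ → ℂ) → ι → ℂ} (hF : ∀ i, DefinableComplexFun L (fun z => F z i)) :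
    DefinableComplexSet L {z | F z ∈ Z} :=
  Set.Definable.preimage_map (DefinableComplexFun.definableMap hF) hZ

theorem and {P Q : (ι → ℂ) → Prop} (hP : DefinableComplexSet L {z | P z})
    (hQ : DefinableComplexSet L {z | Q z}) : DefinableComplexSet L {z | P z ∧ Q z} :=
  Set.Definable.inter hP hQ

theorem or {P Q : (ι → ℂ) → Prop} (hP : DefinableComplexSet L {z | P z})
    (hQ : DefinableComplexSet L {z | Q z}) : DefinableComplexSet L {z | P z ∨ Q z} :=
  Set.Definable.union hP hQ

theorem not {P : (ι → ℂ) → Prop} (hP : DefinableComplexSet L {z | P z}) :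
    DefinableComplexSet L {z | ¬ P z} :=
  Set.Definable.compl hP

theorem imp {P Q : (ι → ℂ) → Prop} (hP : DefinableComplexSet L {z | P z})
    (hQ : DefinableComplexSet L {z | Q z}) : DefinableComplexSet L {z | P z → Q z} := by
  simpa only [imp_iff_not_or] using hP.not.or hQ

theorem eq {f g : (ι → ℂ) → ℂ} (hf : DefinableComplexFun L f) (hg : DefinableComplexFun L g) :
    DefinableComplexSet L {z | f z = g z} := by
  simp only [Complex.ext_iff]
  exact Set.Definable.inter (hf.1.ofPred_eq hg.1) (hf.2.ofPred_eq hg.2)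

/-- Comparison of norms is comparison of sums of squares of real coordinates. -/
theorem norm_lt (hL : IsOMinimalExpansion L) {f g : (ι → ℂ) → ℂ} (hf : DefinableComplexFun L f)
    (hg : DefinableComplexFun L g) : DefinableComplexSet L {z | ‖f z‖ < ‖g z‖} := by
  have key : ∀ z : ι → ℂ, ‖f z‖ < ‖g z‖ ↔
      (f z).re * (f z).re + (f z).im * (f z).im < (g z).re * (g z).re + (g z).im * (g z).im := by
    intro z
    rw [← Complex.normSq_apply, ← Complex.normSq_apply, Complex.normSq_eq_norm_sq,
      Complex.normSq_eq_norm_sq, sq_lt_sq₀ (norm_nonneg _) (norm_nonneg _)]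
  simp only [key]
  exact hL.real_lt (hL.real_add (hL.real_mul hf.1 hf.1) (hL.real_mul hf.2 hf.2))
    (hL.real_add (hL.real_mul hg.1 hg.1) (hL.real_mul hg.2 hg.2))

theorem norm_le (hL : IsOMinimalExpansion L) {f g : (ι → ℂ) → ℂ} (hf : DefinableComplexFun L f)
    (hg : DefinableComplexFun L g) : DefinableComplexSet L {z | ‖f z‖ ≤ ‖g z‖} := by
  simpa only [not_lt] using (norm_lt hL hg hf).not

theorem exists_vector [Finite κ] {P : (ι → ℂ) → (κ → ℂ) → Prop}
    (hP : DefinableComplexSet L {w : ι ⊕ κ → ℂ | P (w ∘ Sum.inl) (w ∘ Sum.inr)}) :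
    DefinableComplexSet L {z | ∃ y, P z y} := by
  have h := Set.Definable.exists_of_finite (α := ι ⊕ ι) (β := κ ⊕ κ)
    (hP.preimage_comp (Sum.elim (Sum.map Sum.inl Sum.inl) (Sum.map Sum.inr Sum.inr)))
  change (Set.univ : Set ℝ).Definable L _
  refine cast (congrArg _ ?_) h
  ext w
  constructor
  · rintro ⟨u, hu⟩
    exact ⟨toComplex u, hu⟩
  · rintro ⟨y, hy⟩
    exact ⟨Sum.elim (fun k => (y k).re) (fun k => (y k).im), hy⟩

theorem exists_coord {P : (ι → ℂ) → ℂ → Prop}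
    (hP : DefinableComplexSet L {w : Option ι → ℂ | P (w ∘ some) (w none)}) :
    DefinableComplexSet L {z | ∃ y, P z y} := by
  have h : DefinableComplexSet L {z : ι → ℂ | ∃ y : Unit → ℂ, P z (y ())} :=
    exists_vector (P := fun z y => P z (y ()))
      (hP.preimage_comp (Sum.map (fun o : Option ι => o.elim (Sum.inr ()) Sum.inl)
        (fun o : Option ι => o.elim (Sum.inr ()) Sum.inl)))
  refine cast (congrArg _ ?_) h
  ext z
  exact ⟨fun ⟨y, hy⟩ => ⟨y (), hy⟩, fun ⟨y, hy⟩ => ⟨fun _ => y, hy⟩⟩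

theorem forall_coord {P : (ι → ℂ) → ℂ → Prop}
    (hP : DefinableComplexSet L {w : Option ι → ℂ | P (w ∘ some) (w none)}) :
    DefinableComplexSet L {z | ∀ y, P z y} := by
  simpa only [not_exists, not_not] using (exists_coord (P := fun z y => ¬ P z y) hP.not).not

/-- The real points of a definable complex set form a definable set. -/
theorem real_trace [Finite ι] {Z : Set (ι → ℂ)} (hZ : DefinableComplexSet L Z) :
    DefinableSet L {x : ι → ℝ | (fun k => (x k : ℂ)) ∈ Z} := by
  have hF : (Set.univ : Set ℝ).DefinableMap L
      (fun x : ι → ℝ => (Sum.elim x (fun _ => 0) : ι ⊕ ι → ℝ)) := by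
    rintro (i | i)
    · exact Set.DefinableFun.proj L
    · exact IsOMinimalExpansion.real_const 0
  exact Set.Definable.preimage_map hF hZ

end DefinableComplexSet

/-- A complex function whose graph is definable is definable. -/
theorem DefinableComplexFun.of_graph {f : (ι → ℂ) → ℂ}
    (hf : DefinableComplexSet L {w : Option ι → ℂ | f (w ∘ some) = w none}) :
    DefinableComplexFun L f := by
  -- A graph point over `w` with prescribed real part `r` and unknown imaginary part `s`.
  constructor
  · have h := Set.Definable.exists_of_finite (α := Option (ι ⊕ ι)) (β := Unit)
      (hf.preimage_comp (Sum.elim (fun o : Option ι => o.elim (Sum.inl none)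
        (fun i => Sum.inl (some (Sum.inl i)))) (fun o : Option ι => o.elim (Sum.inr ())
        (fun i => Sum.inl (some (Sum.inr i))))))
    change (Set.univ : Set ℝ).Definable L _
    refine cast (congrArg _ ?_) h
    ext w
    constructor
    · rintro ⟨s, hs⟩
      exact congrArg Complex.re hs
    · intro hw
      exact ⟨fun _ => (f (toComplex (w ∘ some))).im, Complex.ext hw rfl⟩
  · have h := Set.Definable.exists_of_finite (α := Option (ι ⊕ ι)) (β := Unit)
      (hf.preimage_comp (Sum.elim (fun o : Option ι => o.elim (Sum.inr ())
        (fun i => Sum.inl (some (Sum.inl i)))) (fun o : Option ι => o.elim (Sum.inl none)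
        (fun i => Sum.inl (some (Sum.inr i))))))
    change (Set.univ : Set ℝ).Definable L _
    refine cast (congrArg _ ?_) h
    ext w
    constructor
    · rintro ⟨s, hs⟩
      exact congrArg Complex.im hs
    · intro hw
      exact ⟨fun _ => (f (toComplex (w ∘ some))).re, Complex.ext rfl hw⟩

open Classical in
/-- A definable function on a definable set extends by zero to a definable total function. -/
theorem DefinableComplexFunOn.extend {Z : Set (ι → ℂ)} (hZ : DefinableComplexSet L Z)
    {f : (ι → ℂ) → ℂ} (hf : DefinableComplexFunOn L Z f) :
    DefinableComplexFun L (fun z => if z ∈ Z then f z else 0) := by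
  have key : ∀ g : ((ι ⊕ ι) → ℝ) → ℝ, DefinableFunOn L (toComplex ⁻¹' Z) g →
      (Set.univ : Set ℝ).DefinableFun L (fun w => if toComplex w ∈ Z then g w else 0) := by
    intro g hg
    have h0 : (Set.univ : Set ℝ).Definable L {w : Option (ι ⊕ ι) → ℝ | (0 : ℝ) = w none} :=
      (IsOMinimalExpansion.real_const 0).ofPred_eq (Set.DefinableFun.proj L)
    have hc := (Set.Definable.compl (Set.Definable.preimage_comp some hZ)).inter h0
    change (Set.univ : Set ℝ).Definable L _
    refine cast (congrArg _ ?_) (Set.Definable.union hg hc)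
    ext w
    by_cases h : toComplex (w ∘ some) ∈ Z <;> simp [h, Function.tupleGraph]
  constructor
  · convert key _ hf.1 using 2 with w
    dsimp only
    split_ifs <;> rfl
  · convert key _ hf.2 using 2 with w
    dsimp only
    split_ifs <;> rfl

theorem DefinableComplexFun.restrict {Z : Set (ι → ℂ)} (hZ : DefinableComplexSet L Z)
    {f : (ι → ℂ) → ℂ} (hf : DefinableComplexFun L f) : DefinableComplexFunOn L Z f :=
  ⟨(Set.Definable.preimage_comp some hZ).inter hf.1,
    (Set.Definable.preimage_comp some hZ).inter hf.2⟩

end Definability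

/-! ### Remainders modulo the generic monic polynomial -/

open Filter Topology Polynomial Asymptotics in
/-- A complex polynomial that is `O(P)` at each root of `P` is a multiple of `P`. -/
theorem Polynomial.dvd_of_isBigO {P D : Polynomial ℂ} (hP : P ≠ 0)
    (h : ∀ a, P.IsRoot a → (fun y => D.eval y) =O[𝓝 a] (fun y => P.eval y)) : P ∣ D := by
  rcases eq_or_ne D 0 with rfl | hD
  · exact dvd_zero P
  refine (IsAlgClosed.splits P).dvd_of_roots_le_roots hP ?_
  rw [Multiset.le_iff_count]
  intro a
  rw [count_roots, count_roots]
  by_cases ha : P.IsRoot a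
  swap
  · simp [rootMultiplicity_eq_zero ha]
  by_contra! hlt
  obtain ⟨P₁, hP₁, -⟩ := exists_eq_pow_rootMultiplicity_mul_and_not_dvd P hP a
  obtain ⟨D₁, hD₁, hD₁'⟩ := exists_eq_pow_rootMultiplicity_mul_and_not_dvd D hD a
  obtain ⟨k, hk⟩ := Nat.exists_eq_add_of_lt hlt
  set l := D.rootMultiplicity a
  -- After cancelling `(y - a)^l`, the cofactor of `D` tends to `0` at `a`.
  have hO : (fun y => D₁.eval y) =O[𝓝[≠] a] (fun y => (y - a) ^ (k + 1) * P₁.eval y) := by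
    obtain ⟨C, hC⟩ := (h a ha).bound
    refine IsBigO.of_bound C ?_
    filter_upwards [hC.filter_mono nhdsWithin_le_nhds, self_mem_nhdsWithin] with y hy hya
    have hya' : 0 < ‖(y - a) ^ l‖ := by
      rw [norm_pos_iff]; exact pow_ne_zero _ (sub_ne_zero.mpr hya)
    rw [hD₁, hP₁, hk] at hy
    simp only [eval_mul, eval_pow, eval_sub, eval_X, eval_C, add_assoc, pow_add _ l,
      norm_mul _ _, mul_assoc] at hy
    rw [mul_left_comm] at hy
    simpa [mul_assoc] using le_of_mul_le_mul_left hy hya'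
  have hlim : Tendsto (fun y => (y - a) ^ (k + 1) * P₁.eval y) (𝓝[≠] a) (𝓝 0) := by
    have : Continuous fun y => (y - a) ^ (k + 1) * P₁.eval y := by fun_prop
    simpa using (this.tendsto a).mono_left nhdsWithin_le_nhds
  have h0 : D₁.eval a = 0 :=
    tendsto_nhds_unique ((D₁.continuous.tendsto a).mono_left nhdsWithin_le_nhds)
      (hO.trans_tendsto hlim)
  exact hD₁' (dvd_iff_isRoot.mpr h0)

section GenericPolynomial

open Polynomial Filter Topology Asymptotics

variable {p : ℕ}

/-- The polynomial `∑_{j=1}^p h_j Y^{p-j}`, with `h_j` the value of `h` at `j - 1`. -/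
noncomputable def lowPoly (h : Fin p → ℂ) : ℂ[X] :=
  ∑ j : Fin p, C (h j) * X ^ (p - (j.val + 1))

/-- The generic monic polynomial `Y^p + ∑_{j=1}^p t_j Y^{p-j}` with complex coefficients. -/
noncomputable def monicPoly (t : Fin p → ℂ) : ℂ[X] :=
  X ^ p + lowPoly t

theorem eval_lowPoly (h : Fin p → ℂ) (y : ℂ) :
    (lowPoly h).eval y = ∑ j : Fin p, h j * y ^ (p - (j.val + 1)) := by
  simp [lowPoly, eval_finsetSum]

theorem eval_monicPoly (t : Fin p → ℂ) (y : ℂ) :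
    (monicPoly t).eval y = y ^ p + ∑ j : Fin p, t j * y ^ (p - (j.val + 1)) := by
  simp [monicPoly, eval_lowPoly]

theorem degree_lowPoly_lt (h : Fin p → ℂ) : (lowPoly h).degree < p := by
  refine (degree_sum_le _ _).trans_lt ((Finset.sup_lt_iff (WithBot.bot_lt_coe p)).mpr ?_)
  intro j _
  refine (degree_C_mul_X_pow_le _ _).trans_lt ?_
  have := j.isLt
  exact Nat.cast_lt.mpr (by omega)

theorem monic_monicPoly (t : Fin p → ℂ) : (monicPoly t).Monic :=
  monic_X_pow_add (degree_lowPoly_lt t)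

theorem natDegree_monicPoly (t : Fin p → ℂ) : (monicPoly t).natDegree = p :=
  natDegree_eq_of_degree_eq_some <| by
    rw [monicPoly, degree_add_eq_left_of_degree_lt] <;> rw [degree_X_pow]
    exact degree_lowPoly_lt t

theorem coeff_lowPoly (h : Fin p → ℂ) (i : Fin p) :
    (lowPoly h).coeff (p - (i.val + 1)) = h i := by
  rw [lowPoly, finsetSum_coeff, Finset.sum_eq_single i]
  · simp
  · intro j _ hji
    rw [coeff_C_mul_X_pow, if_neg]
    have := i.isLt
    have := j.isLt
    have : i.val ≠ j.val := fun h => hji (Fin.ext h.symm)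
    omega
  · simp

theorem lowPoly_sub (h k : Fin p → ℂ) : lowPoly (h - k) = lowPoly h - lowPoly k := by
  simp [lowPoly, sub_mul, Finset.sum_sub_distrib]

/-- `h` is the coefficient vector of the remainder in the division of `g` by the generic monic
polynomial `P(t, ·)`: the difference of `g` and `∑ h_j Y^{p-j}` is `O(P(t, ·))` at each root of
`P(t, ·)`. This is Hermite interpolation, multiple roots included, and it is a first-order
condition on `(g, t, h)`. -/
def IsRemainder (g : ℂ → ℂ) (t h : Fin p → ℂ) : Prop :=
  ∀ a, (monicPoly t).eval a = 0 →
    (fun y => g y - (lowPoly h).eval y) =O[𝓝 a] (fun y => (monicPoly t).eval y)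

namespace IsRemainder

variable {g : ℂ → ℂ} {t h k : Fin p → ℂ}

/-- The difference of two remainders has degree less than `p` and is a multiple of `P(t, ·)`. -/
theorem unique (hh : IsRemainder g t h) (hk : IsRemainder g t k) : h = k := by
  have hdvd : monicPoly t ∣ lowPoly (h - k) := by
    refine dvd_of_isBigO (monic_monicPoly t).ne_zero fun a ha => ?_
    refine ((hk a ha).sub (hh a ha)).congr_left fun y => ?_
    rw [lowPoly_sub, eval_sub]
    ring
  have hdeg : (lowPoly (h - k)).degree < (monicPoly t).degree := by
    rw [degree_eq_natDegree (monic_monicPoly t).ne_zero, natDegree_monicPoly]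
    exact degree_lowPoly_lt _
  have h0 := eq_zero_of_dvd_of_degree_lt hdvd hdeg
  funext i
  have := coeff_lowPoly (h - k) i
  rw [h0, coeff_zero] at this
  exact (sub_eq_zero.mp this.symm)

theorem eval_eq (hh : IsRemainder g t h) {a : ℂ} (ha : (monicPoly t).eval a = 0) :
    g a = (lowPoly h).eval a := by
  obtain ⟨C, hC⟩ := (hh a ha).bound
  have := hC.self_of_nhds
  rw [ha, norm_zero, mul_zero] at this
  exact sub_eq_zero.mp (norm_le_zero_iff.mp this)

end IsRemainder

/-- The coefficients of `(Y - s) P(t, Y)`. -/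
noncomputable def mulLinear (t : Fin p → ℂ) (s : ℂ) : Fin (p + 1) → ℂ :=
  fun j => (Fin.snoc (α := fun _ => ℂ) t 0 : Fin (p + 1) → ℂ) j -
    s * (Fin.cons (α := fun _ => ℂ) 1 t : Fin (p + 1) → ℂ) j

theorem eval_lowPoly_succ (h : Fin (p + 1) → ℂ) (y : ℂ) :
    (lowPoly h).eval y = h 0 * y ^ p + (lowPoly (Fin.tail h)).eval y := by
  simp only [eval_lowPoly, Fin.sum_univ_succ, Fin.tail]
  simp

theorem eval_lowPoly_snoc (t : Fin p → ℂ) (c y : ℂ) :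
    (lowPoly (Fin.snoc (α := fun _ => ℂ) t c : Fin (p + 1) → ℂ)).eval y =
      y * (lowPoly t).eval y + c := by
  simp only [eval_lowPoly, Fin.sum_univ_castSucc, Fin.snoc_castSucc, Fin.snoc_last,
    Finset.mul_sum]
  congr 1
  · refine Finset.sum_congr rfl fun j _ => ?_
    have hj : p + 1 - (j.castSucc.val + 1) = (p - (j.val + 1)) + 1 := by
      have := j.isLt
      simp only [Fin.val_castSucc]
      omega
    rw [hj, pow_succ]
    ring
  · simp

theorem eval_monicPoly_mulLinear (t : Fin p → ℂ) (s y : ℂ) :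
    (monicPoly (mulLinear t s)).eval y = (y - s) * (monicPoly t).eval y := by
  have h1 : (lowPoly (mulLinear t s)).eval y =
      (lowPoly (Fin.snoc (α := fun _ => ℂ) t 0 : Fin (p + 1) → ℂ)).eval y -
      s * (lowPoly (Fin.cons (α := fun _ => ℂ) 1 t : Fin (p + 1) → ℂ)).eval y := by
    simp only [eval_lowPoly, mulLinear, sub_mul, Finset.sum_sub_distrib, Finset.mul_sum, mul_assoc]
  rw [monicPoly, eval_add, h1, eval_lowPoly_snoc, eval_lowPoly_succ, Fin.cons_zero, Fin.tail_cons,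
    monicPoly, eval_add, eval_pow, eval_pow, eval_X]
  ring

/-- The remainder `h` modulo `(Y - s) P(t, Y)` reduces modulo `P(t, Y)` to `h - h_1 P(t, Y)`. -/
theorem IsRemainder.of_mulLinear {g : ℂ → ℂ} {t : Fin p → ℂ} {s : ℂ} {h : Fin (p + 1) → ℂ}
    (hh : IsRemainder g (mulLinear t s) h) :
    IsRemainder g t (fun j => h j.succ - h 0 * t j) := by
  intro a ha
  have h1 := hh a (by rw [eval_monicPoly_mulLinear, ha, mul_zero])
  simp only [eval_monicPoly_mulLinear] at h1
  have h2 : (fun y => (y - s) * (monicPoly t).eval y) =O[𝓝 a] fun y => (monicPoly t).eval y := by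
    have hc : (fun y : ℂ => y - s) =O[𝓝 a] fun _ => (1 : ℂ) :=
      ((continuous_id.sub continuous_const).tendsto a).isBigO_one ℂ
    simpa using hc.mul (isBigO_refl (fun y => (monicPoly t).eval y) (𝓝 a))
  refine ((h1.trans h2).add ((isBigO_refl _ _).const_mul_left (h 0))).congr_left fun y => ?_
  have h3 : (lowPoly fun j => h j.succ - h 0 * t j).eval y =
      (lowPoly (Fin.tail h)).eval y - h 0 * (lowPoly t).eval y := by
    simp only [eval_lowPoly, sub_mul, Finset.sum_sub_distrib, Finset.mul_sum, mul_assoc, Fin.tail]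
  rw [h3, eval_lowPoly_succ, monicPoly, eval_add, eval_pow, eval_X]
  ring

/-- Division with remainder, where the quotient at `s` is the leading coefficient of the remainder
modulo `(Y - s) P(t, Y)`. -/
theorem IsRemainder.division {g : ℂ → ℂ} {t h : Fin p → ℂ} {s : ℂ} {k : Fin (p + 1) → ℂ}
    (hh : IsRemainder g t h) (hk : IsRemainder g (mulLinear t s) k) :
    g s = k 0 * (monicPoly t).eval s + (lowPoly h).eval s := by
  have h1 : g s = (lowPoly k).eval s :=
    hk.eval_eq (by rw [eval_monicPoly_mulLinear, sub_self, zero_mul])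
  have h2 : (lowPoly h).eval s = (lowPoly (Fin.tail k)).eval s - k 0 * (lowPoly t).eval s := by
    rw [hh.unique hk.of_mulLinear]
    simp only [eval_lowPoly, sub_mul, Finset.sum_sub_distrib, Finset.mul_sum, mul_assoc, Fin.tail]
  rw [h1, h2, eval_lowPoly_succ, monicPoly, eval_add, eval_pow, eval_X]
  ring

/-- The coefficients of the difference quotient `(P(t, ζ) - P(t, y)) / (ζ - y)` as a polynomial
in `y` are polynomials in `(t, ζ)`. -/
theorem exists_monicPoly_sub_eq (p : ℕ) :
    ∃ c : Fin p → (Fin p → ℂ) × ℂ → ℂ, (∀ j, Differentiable ℂ (c j)) ∧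
      ∀ t ζ y, (monicPoly t).eval ζ - (monicPoly t).eval y =
        (ζ - y) * (lowPoly fun j => c j (t, ζ)).eval y := by
  induction p with
  | zero =>
    exact ⟨fun j => j.elim0, fun j => j.elim0,
      fun t ζ y => by simp [eval_monicPoly, eval_lowPoly]⟩
  | succ p ih =>
    obtain ⟨c, hc, hcy⟩ := ih
    have hinit : Differentiable ℂ fun w : (Fin (p + 1) → ℂ) × ℂ =>
        ((fun j => w.1 j.castSucc : Fin p → ℂ), w.2) := by fun_prop
    refine ⟨Fin.snoc (α := fun _ => _) (fun j w => c j (fun i => w.1 i.castSucc, w.2))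
      (fun w => (monicPoly fun i : Fin p => w.1 i.castSucc).eval w.2), fun j => ?_,
      fun t ζ y => ?_⟩
    · refine Fin.lastCases ?_ (fun j => ?_) j
      · simp only [Fin.snoc_last, eval_monicPoly]
        fun_prop
      · simp only [Fin.snoc_castSucc]
        exact (hc j).comp hinit
    · -- `P_{p+1}(t, y) = y P_p(t', y) + t_{p+1}`
      set t' : Fin p → ℂ := fun i => t i.castSucc
      have hP : ∀ y, (monicPoly t).eval y = y * (monicPoly t').eval y + t (Fin.last p) := by
        intro y
        have ht : t = Fin.snoc (α := fun _ => ℂ) t' (t (Fin.last p)) :=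
          (Fin.snoc_init_self t).symm
        rw [monicPoly, eval_add, ht, eval_lowPoly_snoc, ← ht, monicPoly, eval_add, eval_pow,
          eval_pow, eval_X]
        ring
      have hlow : (fun j => (Fin.snoc (α := fun _ => (Fin (p + 1) → ℂ) × ℂ → ℂ)
          (fun j w => c j (fun i => w.1 i.castSucc, w.2))
          (fun w => (monicPoly fun i : Fin p => w.1 i.castSucc).eval w.2) :
            Fin (p + 1) → (Fin (p + 1) → ℂ) × ℂ → ℂ) j (t, ζ)) =
          Fin.snoc (α := fun _ => ℂ) (fun j => c j (t', ζ)) ((monicPoly t').eval ζ) := by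
        funext j
        refine Fin.lastCases ?_ (fun j => ?_) j <;> simp [t']
      rw [hlow, eval_lowPoly_snoc, hP, hP]
      linear_combination y * hcy t' ζ y

end GenericPolynomial

open Polynomial in
/-- The roots of the polynomial with coefficients `σ(b)` are the `b_j`. -/
theorem eval_monicPoly_signedEsymm {p : ℕ} (b : Fin p → ℝ) (y : ℂ) :
    (monicPoly fun j => (signedEsymm b j : ℂ)).eval y = ∏ j, (y - (b j : ℂ)) := by
  have h := congrArg (Polynomial.eval y) (Multiset.prod_X_sub_X_eq_sum_esymm
    ((Finset.univ : Finset (Fin p)).val.map fun j => (b j : ℂ)))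
  have hs : ∀ k, ((Finset.univ : Finset (Fin p)).val.map fun j => (b j : ℂ)).esymm k =
      ((MvPolynomial.eval b (MvPolynomial.esymm (Fin p) ℝ k) : ℝ) : ℂ) := by
    intro k
    rw [← MvPolynomial.aeval_esymm_eq_multiset_esymm (Fin p) ℝ]
    exact MvPolynomial.aeval_algebraMap_apply ℂ b _
  simp only [hs, Multiset.map_map, Multiset.card_map, Finset.card_val, Finset.card_univ,
    Fintype.card_fin, Finset.sum_range_succ', Function.comp_def] at h
  have hprod : (Multiset.map (fun j => X - C (b j : ℂ)) (Finset.univ : Finset (Fin p)).val).prod =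
      ∏ j, (X - C (b j : ℂ)) := rfl
  rw [hprod, eval_prod] at h
  simp only [eval_sub, eval_X, eval_C] at h
  rw [h, eval_monicPoly, eval_add, add_comm, eval_finsetSum, Finset.sum_range]
  refine congrArg₂ _ (Finset.sum_congr rfl fun j _ => ?_) ?_
  · simp [signedEsymm, mul_assoc]
  · simp

/-! ### Holomorphic dependence of circle integrals on parameters -/

section ParametricCircleIntegral

open Metric Filter Topology MeasureTheory Set

/-- Integrals over a circle of a function that is holomorphic in all variables depend
holomorphically on the parameters. -/
theorem differentiableAt_circleIntegral {ι : Type*} [Fintype ι] {f : (ι → ℂ) → ℂ → ℂ}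
    {U : Set ((ι → ℂ) × ℂ)} (hU : IsOpen U)
    (hf : DifferentiableOn ℂ (fun w : (ι → ℂ) × ℂ => f w.1 w.2) U)
    {x₀ : ι → ℂ} {c : ℂ} {R : ℝ} (hR : 0 ≤ R) (hx₀ : ∀ ζ ∈ sphere c R, (x₀, ζ) ∈ U) :
    DifferentiableAt ℂ (fun x => ∮ ζ in C(c, R), f x ζ) x₀ := by
  classical
  have hcont₀ : ContinuousOn (fun ζ => f x₀ ζ) (sphere c R) :=
    hf.continuousOn.comp (f := fun ζ => (x₀, ζ)) (by fun_prop) hx₀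
  obtain ⟨C, hC⟩ := (isCompact_sphere c R).exists_bound_of_continuousOn hcont₀
  have hev : ∀ᶠ x in 𝓝 x₀, ∀ ζ ∈ sphere c R, (x, ζ) ∈ U ∧ ‖f x ζ‖ < |C| + 1 := by
    refine (isCompact_sphere c R).eventually_forall_of_forall_eventually
      (P := fun x ζ => (x, ζ) ∈ U ∧ ‖f x ζ‖ < |C| + 1) fun ζ hζ => ?_
    have hmem : U ∈ 𝓝 (x₀, ζ) := hU.mem_nhds (hx₀ ζ hζ)
    have hlt : ‖f x₀ ζ‖ < |C| + 1 :=
      ((hC ζ hζ).trans (le_abs_self C)).trans_lt (lt_add_one _)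
    have hc := (hf.continuousOn.continuousAt hmem).norm
    filter_upwards [hmem, hc.eventually (gt_mem_nhds hlt)] with w hw hw'
    exact ⟨hw, hw'⟩
  obtain ⟨ε, hε, hball⟩ := Metric.eventually_nhds_iff_ball.mp hev
  set M : ℝ := |C| + 1
  have hM : 0 < M := by positivity
  have hmaps : ∀ θ, circleMap c R θ ∈ sphere c R := circleMap_mem_sphere c hR
  have hdiff : ∀ ζ ∈ sphere c R, DifferentiableOn ℂ (fun x => f x ζ) (ball x₀ ε) := fun ζ hζ =>
    hf.comp (f := fun x => (x, ζ)) (by fun_prop) fun x hx => (hball x hx ζ hζ).1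
  have hcont : ∀ x ∈ ball x₀ ε, Continuous fun θ => f x (circleMap c R θ) := fun x hx =>
    (hf.continuousOn.comp_continuous (f := fun θ => (x, circleMap c R θ))
      (by fun_prop) fun θ => (hball x hx _ (hmaps θ)).1)
  have hx₀mem : x₀ ∈ ball x₀ ε := mem_ball_self hε
  -- The Schwarz lemma turns the local bound `M` into a uniform Lipschitz bound.
  have hlip : ∀ ζ ∈ sphere c R, ∀ x ∈ ball x₀ ε,
      ‖f x ζ - f x₀ ζ‖ ≤ (2 * M / ε) * ‖x - x₀‖ := by
    intro ζ hζ x hx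
    rw [← dist_eq_norm, ← dist_eq_norm]
    refine Complex.dist_le_div_mul_dist_of_mapsTo_ball (hdiff ζ hζ) (fun y hy => ?_) hx
    rw [mem_closedBall, dist_eq_norm]
    have h1 := (hball y hy ζ hζ).2
    have h2 := (hball x₀ hx₀mem ζ hζ).2
    linarith [norm_sub_le (f y ζ) (f x₀ ζ)]
  let D : ℝ → (ι → ℂ) →L[ℂ] ℂ := fun θ => fderiv ℂ (fun x => f x (circleMap c R θ)) x₀
  have hD : ∀ θ, HasFDerivAt (fun x => f x (circleMap c R θ)) (D θ) x₀ := fun θ =>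
    ((hdiff _ (hmaps θ)).differentiableAt (ball_mem_nhds x₀ hε)).hasFDerivAt
  -- Each directional derivative is a limit of difference quotients, hence measurable in `θ`.
  have hDv : ∀ v, StronglyMeasurable fun θ => D θ v := by
    intro v
    have hlim : Tendsto (fun n : ℕ => x₀ + ((n : ℂ) + 1)⁻¹ • v) atTop (𝓝 x₀) := by
      have h0 : Tendsto (fun n : ℕ => ((n : ℂ) + 1)⁻¹) atTop (𝓝 0) := by
        simpa [one_div] using tendsto_one_div_add_atTop_nhds_zero_nat (𝕜 := ℂ)
      simpa using (h0.smul_const v).const_add x₀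
    obtain ⟨N, hN⟩ := eventually_atTop.mp (hlim.eventually (ball_mem_nhds x₀ hε))
    refine stronglyMeasurable_of_tendsto (u := atTop) (f := fun n : ℕ => fun θ =>
      (((n + N : ℕ) : ℂ) + 1) •
        (f (x₀ + (((n + N : ℕ) : ℂ) + 1)⁻¹ • v) (circleMap c R θ) - f x₀ (circleMap c R θ)))
      (fun n => ?_) ?_
    · have h1 := hcont _ (hN (n + N) (Nat.le_add_left _ _))
      have h2 := hcont x₀ hx₀mem
      refine Continuous.stronglyMeasurable ?_
      simp only [smul_eq_mul]
      exact continuous_const.mul (h1.sub h2)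
    · rw [tendsto_pi_nhds]
      intro θ
      refine Tendsto.comp (f := fun n : ℕ => n + N) (g := fun n : ℕ => ((n : ℂ) + 1) •
        (f (x₀ + ((n : ℂ) + 1)⁻¹ • v) (circleMap c R θ) - f x₀ (circleMap c R θ)))
        ?_ (tendsto_add_atTop_nat N)
      have hn : Tendsto (fun n : ℕ => ‖(n : ℂ) + 1‖) atTop atTop := by
        have : ∀ n : ℕ, ‖(n : ℂ) + 1‖ = (n : ℝ) + 1 := fun n => by
          exact_mod_cast Complex.norm_natCast (n + 1)
        simp only [this]
        exact tendsto_atTop_add_const_right _ _ tendsto_natCast_atTop_atTop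
      exact (hD θ).lim v hn
  have hDmeas : StronglyMeasurable D := by
    have : D = fun θ => ∑ i, D θ (Pi.single i 1) • ContinuousLinearMap.proj (R := ℂ) i := by
      funext θ
      refine ContinuousLinearMap.ext fun v => ?_
      conv_lhs => rw [pi_eq_sum_univ' v]
      simp [map_sum, mul_comm]
    rw [this]
    exact Finset.stronglyMeasurable_fun_sum _ fun i _ => (hDv _).smul_const _
  have hderiv : Continuous fun θ => deriv (circleMap c R) θ := by
    simp only [deriv_circleMap]
    fun_prop
  have key := (hasFDerivAt_integral_of_dominated_loc_of_lip' (𝕜 := ℂ) (x₀ := x₀)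
    (μ := volume.restrict (Ioc 0 (2 * Real.pi)))
    (F := fun x θ => deriv (circleMap c R) θ • f x (circleMap c R θ))
    (F' := fun θ => deriv (circleMap c R) θ • D θ) (bound := fun _ => R * (2 * M / ε))
    (ball_mem_nhds x₀ hε) ?_ ?_ ?_ ?_ ?_ ?_).2
  · simp only [circleIntegral, intervalIntegral.integral_of_le Real.two_pi_pos.le]
    exact key.differentiableAt
  · exact fun x hx => (hderiv.smul (hcont x hx)).aestronglyMeasurable
  · exact (hderiv.smul (hcont x₀ hx₀mem)).integrableOn_Ioc
  · exact (hderiv.stronglyMeasurable.smul hDmeas).aestronglyMeasurable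
  · refine ae_of_all _ fun θ x hx => ?_
    rw [← smul_sub, norm_smul, deriv_circleMap, norm_mul, Complex.norm_I, mul_one,
      norm_circleMap_zero, abs_of_nonneg hR, mul_assoc]
    exact mul_le_mul_of_nonneg_left (hlip _ (hmaps θ) x hx) hR
  · exact integrable_const _
  · exact ae_of_all _ fun θ => (hD θ).fun_const_smul _

end ParametricCircleIntegral

/-! ### The remainder as a Cauchy integral -/

section LocalRemainder

open Metric Filter Topology Set Polynomial Asymptotics

variable {p : ℕ}

theorem norm_le_of_eval_monicPoly_eq_zero {t : Fin p → ℂ} {y : ℂ}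
    (h : (monicPoly t).eval y = 0) : ‖y‖ ≤ 1 + ∑ j, ‖t j‖ := by
  by_contra! hlt
  have hS : 0 ≤ ∑ j, ‖t j‖ := Finset.sum_nonneg fun j _ => norm_nonneg _
  have h1 : 1 < ‖y‖ := by linarith
  rw [eval_monicPoly] at h
  rcases Nat.eq_zero_or_pos p with rfl | hp
  · simp at h
  obtain ⟨k, rfl⟩ : ∃ k, p = k + 1 := ⟨p - 1, by omega⟩
  have h2 : ‖y‖ ^ (k + 1) ≤ (∑ j, ‖t j‖) * ‖y‖ ^ k := by
    rw [← norm_pow, eq_neg_of_add_eq_zero_left h, norm_neg, Finset.sum_mul]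
    refine (norm_sum_le _ _).trans (Finset.sum_le_sum fun j _ => ?_)
    rw [norm_mul, norm_pow]
    exact mul_le_mul_of_nonneg_left (pow_le_pow_right₀ h1.le (by omega)) (norm_nonneg _)
  rw [pow_succ'] at h2
  have := le_of_mul_le_mul_right h2 (by positivity)
  linarith

theorem differentiable_eval_monicPoly :
    Differentiable ℂ fun w : (Fin p → ℂ) × ℂ => (monicPoly w.1).eval w.2 := by
  simp only [eval_monicPoly]
  fun_prop

/-- Roots depend continuously on the coefficients: an open condition satisfied by all the roots
of a monic polynomial is satisfied by all the roots of its small perturbations. -/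
theorem eventually_forall_root {X : Type*} [TopologicalSpace X] {T : X → Fin p → ℂ}
    (hT : Continuous T) {U : Set (X × ℂ)} (hU : IsOpen U) {x₀ : X}
    (hx₀ : ∀ y, (monicPoly (T x₀)).eval y = 0 → (x₀, y) ∈ U) :
    ∀ᶠ x in 𝓝 x₀, ∀ y, (monicPoly (T x)).eval y = 0 → (x, y) ∈ U := by
  have hP : Continuous fun w : X × ℂ => (monicPoly (T w.1)).eval w.2 :=
    differentiable_eval_monicPoly.continuous.comp
      (g := fun w : (Fin p → ℂ) × ℂ => (monicPoly w.1).eval w.2)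
      (f := fun w : X × ℂ => (T w.1, w.2)) (by fun_prop)
  set M : ℝ := 1 + ∑ j, ‖T x₀ j‖ + 1
  have hbound : ∀ᶠ x in 𝓝 x₀, 1 + ∑ j, ‖T x j‖ < M := by
    have : Continuous fun x => 1 + ∑ j, ‖T x j‖ := by fun_prop
    exact this.continuousAt.eventually (gt_mem_nhds (lt_add_one _))
  have hcompact := (isCompact_closedBall (0 : ℂ) M).eventually_forall_of_forall_eventually
    (x₀ := x₀) (P := fun x y => (monicPoly (T x)).eval y = 0 → (x, y) ∈ U) fun y _ => by
      by_cases hy : (monicPoly (T x₀)).eval y = 0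
      · filter_upwards [hU.mem_nhds (hx₀ y hy)] with w hw _
        exact hw
      · filter_upwards [hP.continuousAt.eventually_ne hy] with w hw h
        exact absurd h hw
  filter_upwards [hbound, hcompact] with x hx hx' y hy
  refine hx' y ?_ hy
  rw [mem_closedBall_zero_iff]
  exact (norm_le_of_eval_monicPoly_eq_zero hy).trans hx.le

/-- With `c` the coefficients of the difference quotient of `P`, the polynomial with coefficients
`∮ g c_j / P` is the Cauchy integral of `g` minus a multiple of `P`. -/
theorem eval_lowPoly_circleIntegral {g : ℂ → ℂ} {t : Fin p → ℂ} {c : Fin p → ℂ → ℂ}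
    (hc : ∀ j, Continuous (c j))
    (hct : ∀ ζ y, (monicPoly t).eval ζ - (monicPoly t).eval y =
      (ζ - y) * (lowPoly fun j => c j ζ).eval y)
    {b : ℂ} {r : ℝ} (hr : 0 ≤ r) (hg : ContinuousOn g (sphere b r))
    (hP : ∀ ζ ∈ sphere b r, (monicPoly t).eval ζ ≠ 0) {y : ℂ} (hy : y ∉ sphere b r) :
    (lowPoly fun j => ∮ ζ in C(b, r), g ζ * c j ζ / (monicPoly t).eval ζ).eval y =
      (∮ ζ in C(b, r), (ζ - y)⁻¹ • g ζ) -
        (monicPoly t).eval y * ∮ ζ in C(b, r), g ζ / ((monicPoly t).eval ζ * (ζ - y)) := by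
  have hne : ∀ ζ ∈ sphere b r, ζ - y ≠ 0 := fun ζ hζ h =>
    hy (by rwa [sub_eq_zero.mp h] at hζ)
  have hPc : ContinuousOn (fun ζ => (monicPoly t).eval ζ) (sphere b r) :=
    (monicPoly t).continuous.continuousOn
  have hlin : ContinuousOn (fun ζ => ζ - y) (sphere b r) := by fun_prop
  have h1 : (lowPoly fun j => ∮ ζ in C(b, r), g ζ * c j ζ / (monicPoly t).eval ζ).eval y =
      ∮ ζ in C(b, r), ∑ j : Fin p,
        y ^ (p - (j.val + 1)) * (g ζ * c j ζ / (monicPoly t).eval ζ) := by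
    rw [circleIntegral.integral_fun_sum, eval_lowPoly]
    · refine Finset.sum_congr rfl fun j _ => ?_
      rw [circleIntegral.integral_const_mul, mul_comm]
    · intro j _
      exact ContinuousOn.circleIntegrable hr (continuousOn_const.mul
        ((hg.mul (hc j).continuousOn).div hPc hP))
  rw [h1, ← circleIntegral.integral_const_mul, ← circleIntegral.integral_sub]
  · refine circleIntegral.integral_congr hr fun ζ hζ => ?_
    have hs : ∑ j : Fin p, y ^ (p - (j.val + 1)) * (g ζ * c j ζ / (monicPoly t).eval ζ) =
        g ζ / (monicPoly t).eval ζ * (lowPoly fun j => c j ζ).eval y := by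
      rw [eval_lowPoly, Finset.mul_sum]
      refine Finset.sum_congr rfl fun j _ => ?_
      ring
    have h2 := hct ζ y
    have h3 := hne ζ hζ
    have h4 := hP ζ hζ
    simp only [hs, smul_eq_mul]
    field_simp
    linear_combination (-g ζ) * h2
  · exact ContinuousOn.circleIntegrable hr ((hlin.inv₀ hne).smul hg)
  · exact ContinuousOn.circleIntegrable hr (continuousOn_const.mul
      (hg.div (hPc.mul hlin) fun ζ hζ => mul_ne_zero (hP ζ hζ) (hne ζ hζ)))

/-- Around a parameter `x₀` for which `G(x₀, ·)` is holomorphic near the roots of `P(T x₀, ·)`, a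
remainder exists and is holomorphic in the parameter. -/
theorem exists_differentiableAt_isRemainder {ι : Type*} [Fintype ι] {T : (ι → ℂ) → Fin p → ℂ}
    (hT : Differentiable ℂ T) {U : Set ((ι → ℂ) × ℂ)} (hU : IsOpen U) {G : (ι → ℂ) → ℂ → ℂ}
    (hG : DifferentiableOn ℂ (fun w : (ι → ℂ) × ℂ => G w.1 w.2) U) {x₀ : ι → ℂ}
    (hx₀ : ∀ y, (monicPoly (T x₀)).eval y = 0 → (x₀, y) ∈ U) :
    ∃ H : (ι → ℂ) → Fin p → ℂ, (∀ j, DifferentiableAt ℂ (fun x => H x j) x₀) ∧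
      ∀ᶠ x in 𝓝 x₀, IsRemainder (G x) (T x) (H x) := by
  classical
  obtain ⟨c, hc, hct⟩ := exists_monicPoly_sub_eq p
  set S : Finset ℂ := (monicPoly (T x₀)).roots.toFinset
  have hS : ∀ y, y ∈ S ↔ (monicPoly (T x₀)).eval y = 0 := fun y => by
    simp [S, (monic_monicPoly (T x₀)).ne_zero]
  -- Disjoint closed discs of a common radius around the roots at `x₀`, contained in the fibre.
  obtain ⟨r, hr, hrU, hrS⟩ : ∃ r > 0, (∀ a ∈ S, ∀ ζ ∈ closedBall a r, (x₀, ζ) ∈ U) ∧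
      ∀ a ∈ S, ∀ b ∈ S, a ≠ b → 2 * r < dist a b := by
    have h1 : ∀ᶠ r in 𝓝[>] (0 : ℝ), ∀ a ∈ S, ∀ ζ ∈ closedBall a r, (x₀, ζ) ∈ U := by
      refine (Filter.eventually_all_finset S).mpr fun a ha => ?_
      have hopen : IsOpen {ζ : ℂ | (x₀, ζ) ∈ U} := hU.preimage (by fun_prop)
      obtain ⟨ε, hε, hball⟩ := Metric.isOpen_iff.mp hopen a (hx₀ a ((hS a).mp ha))
      filter_upwards [nhdsWithin_le_nhds (gt_mem_nhds hε)] with r hr ζ hζ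
      exact hball (closedBall_subset_ball hr hζ)
    have h2 : ∀ᶠ r in 𝓝[>] (0 : ℝ), ∀ a ∈ S, ∀ b ∈ S, a ≠ b → 2 * r < dist a b := by
      refine (Filter.eventually_all_finset S).mpr fun a _ =>
        (Filter.eventually_all_finset S).mpr fun b _ => ?_
      by_cases hab : a = b
      · exact Eventually.of_forall fun r h => absurd hab h
      · filter_upwards [nhdsWithin_le_nhds (gt_mem_nhds (half_pos (dist_pos.mpr hab)))] with r hr _
        linarith
    obtain ⟨r, ⟨hr1, hr2⟩, hr0⟩ := ((h1.and h2).and self_mem_nhdsWithin).exists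
    exact ⟨r, hr0, hr1, hr2⟩
  have hev1 : ∀ᶠ x in 𝓝 x₀, ∀ a ∈ S, ∀ ζ ∈ closedBall a r, (x, ζ) ∈ U :=
    (Filter.eventually_all_finset S).mpr fun a ha =>
      (isCompact_closedBall a r).eventually_forall_of_forall_eventually
        (P := fun x ζ => (x, ζ) ∈ U) fun ζ hζ => hU.mem_nhds (hrU a ha ζ hζ)
  have hev2 : ∀ᶠ x in 𝓝 x₀, ∀ y, (monicPoly (T x)).eval y = 0 → ∃ a ∈ S, y ∈ ball a r := by
    have hopen : IsOpen {w : (ι → ℂ) × ℂ | ∃ a ∈ S, w.2 ∈ ball a r} := by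
      have : {w : (ι → ℂ) × ℂ | ∃ a ∈ S, w.2 ∈ ball a r} =
          Prod.snd ⁻¹' ⋃ a ∈ S, ball a r := by
        ext w; simp
      rw [this]
      exact (isOpen_biUnion fun a _ => isOpen_ball).preimage continuous_snd
    exact eventually_forall_root hT.continuous hopen fun y hy =>
      ⟨y, (hS y).mpr hy, mem_ball_self hr⟩
  have hne : ∀ x, (∀ y, (monicPoly (T x)).eval y = 0 → ∃ a ∈ S, y ∈ ball a r) →
      ∀ a ∈ S, ∀ ζ ∈ sphere a r, (monicPoly (T x)).eval ζ ≠ 0 := by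
    intro x hx a ha ζ hζ h0
    obtain ⟨b, hb, hζb⟩ := hx ζ h0
    rw [mem_sphere] at hζ
    rw [mem_ball] at hζb
    rcases eq_or_ne a b with rfl | hab
    · exact hζb.ne hζ
    · have := hrS a ha b hb hab
      have := dist_triangle_left a b ζ
      linarith
  have hPd : Differentiable ℂ fun w : (ι → ℂ) × ℂ => (monicPoly (T w.1)).eval w.2 :=
    differentiable_eval_monicPoly.comp
      (g := fun w : (Fin p → ℂ) × ℂ => (monicPoly w.1).eval w.2)
      (f := fun w : (ι → ℂ) × ℂ => (T w.1, w.2)) (by fun_prop)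
  let H : (ι → ℂ) → Fin p → ℂ := fun x j => (2 * Real.pi * Complex.I : ℂ)⁻¹ *
    ∑ a ∈ S, ∮ ζ in C(a, r), G x ζ * c j (T x, ζ) / (monicPoly (T x)).eval ζ
  refine ⟨H, fun j => ?_, ?_⟩
  · refine DifferentiableAt.const_mul (DifferentiableAt.fun_sum fun a ha => ?_) _
    have hcj : Differentiable ℂ fun w : (ι → ℂ) × ℂ => c j (T w.1, w.2) :=
      (hc j).comp (f := fun w : (ι → ℂ) × ℂ => (T w.1, w.2)) (by fun_prop)
    refine differentiableAt_circleIntegral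
      (U := U ∩ {w | (monicPoly (T w.1)).eval w.2 ≠ 0})
      (f := fun x ζ => G x ζ * c j (T x, ζ) / (monicPoly (T x)).eval ζ)
      (hU.inter (isOpen_ne_fun hPd.continuous continuous_const)) ?_ hr.le fun ζ hζ =>
        ⟨hrU a ha ζ (sphere_subset_closedBall hζ), hne x₀ hev2.self_of_nhds a ha ζ hζ⟩
    simp only [div_eq_mul_inv]
    exact ((hG.mono inter_subset_left).mul hcj.differentiableOn).mul
      (hPd.differentiableOn.inv fun w hw => hw.2)
  · filter_upwards [hev1, hev2] with x hx1 hx2 α hα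
    obtain ⟨a, ha, hαa⟩ := hx2 α hα
    have hGx : ∀ b ∈ S, DifferentiableOn ℂ (G x) (closedBall b r) := fun b hb =>
      hG.comp (f := fun ζ => (x, ζ)) (by fun_prop) fun ζ hζ => hx1 b hb ζ hζ
    have hfar : ∀ y ∈ ball a r, ∀ b ∈ S, b ≠ a → y ∉ closedBall b r := by
      intro y hy b hb hba hyb
      rw [mem_ball] at hy
      rw [mem_closedBall] at hyb
      have := hrS b hb a ha hba
      have := dist_triangle_left b a y
      linarith
    have hsph : ∀ y ∈ ball a r, ∀ b ∈ S, y ∉ sphere b r := by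
      intro y hy b hb hyb
      rcases eq_or_ne b a with rfl | hba
      · rw [mem_ball] at hy
        exact hy.ne hyb
      · exact hfar y hy b hb hba (sphere_subset_closedBall hyb)
    -- Cauchy: only the disc containing `y` contributes.
    have hcauchy : ∀ y ∈ ball a r,
        ∑ b ∈ S, (∮ ζ in C(b, r), (ζ - y)⁻¹ • G x ζ) = 2 * Real.pi * Complex.I * G x y := by
      intro y hy
      rw [Finset.sum_eq_single_of_mem a ha]
      · rw [(hGx a ha).circleIntegral_sub_inv_smul hy, smul_eq_mul]
      · intro b hb hba
        have hd : DifferentiableOn ℂ (fun ζ => (ζ - y)⁻¹ • G x ζ) (closedBall b r) := by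
          refine DifferentiableOn.smul (DifferentiableOn.inv (h := fun ζ => ζ - y) (by fun_prop)
            fun ζ hζ h => ?_) (hGx b hb)
          exact hfar y hy b hb hba (by rwa [← sub_eq_zero.mp h])
        exact (hd.mono closure_ball_subset_closedBall).diffContOnCl.circleIntegral_eq_zero hr.le
    let K : ℂ → ℂ := fun y => ∑ b ∈ S,
      ∮ ζ in C(b, r), G x ζ / ((monicPoly (T x)).eval ζ * (ζ - y))
    have hid : ∀ y ∈ ball a r, G x y - (lowPoly (H x)).eval y =
        (2 * Real.pi * Complex.I : ℂ)⁻¹ * K y * (monicPoly (T x)).eval y := by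
      intro y hy
      have hlow : (lowPoly (H x)).eval y = (2 * Real.pi * Complex.I : ℂ)⁻¹ * ∑ b ∈ S,
          (lowPoly fun j => ∮ ζ in C(b, r),
            G x ζ * c j (T x, ζ) / (monicPoly (T x)).eval ζ).eval y := by
        simp only [eval_lowPoly, H, Finset.mul_sum, Finset.sum_mul]
        rw [Finset.sum_comm]
        simp only [mul_assoc]
      have hterm : ∀ b ∈ S, (lowPoly fun j => ∮ ζ in C(b, r),
            G x ζ * c j (T x, ζ) / (monicPoly (T x)).eval ζ).eval y =
          (∮ ζ in C(b, r), (ζ - y)⁻¹ • G x ζ) - (monicPoly (T x)).eval y *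
            ∮ ζ in C(b, r), G x ζ / ((monicPoly (T x)).eval ζ * (ζ - y)) := fun b hb =>
        eval_lowPoly_circleIntegral (c := fun j ζ => c j (T x, ζ))
          (fun j => (hc j).continuous.comp (by fun_prop)) (fun ζ y => hct (T x) ζ y) hr.le
          ((hGx b hb).continuousOn.mono sphere_subset_closedBall) (hne x hx2 b hb)
          (hsph y hy b hb)
      rw [hlow, Finset.sum_congr rfl hterm, Finset.sum_sub_distrib, hcauchy y hy,
        ← Finset.mul_sum, mul_sub, inv_mul_cancel_left₀ Complex.two_pi_I_ne_zero]
      simp only [K]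
      ring
    have hK : ContinuousAt K α := by
      refine tendsto_finsetSum _ fun b hb => ?_
      have hd := differentiableAt_circleIntegral (ι := Unit) (c := b) (R := r)
        (f := fun y ζ => G x ζ / ((monicPoly (T x)).eval ζ * (ζ - y ())))
        (U := {w | (x, w.2) ∈ U} ∩ {w | (monicPoly (T x)).eval w.2 * (w.2 - w.1 ()) ≠ 0})
        (x₀ := fun _ => α) ?_ ?_ hr.le fun ζ hζ =>
          ⟨hx1 b hb ζ (sphere_subset_closedBall hζ), mul_ne_zero (hne x hx2 b hb ζ hζ)
            fun h => hsph α hαa b hb ((sub_eq_zero.mp h : ζ = α) ▸ hζ)⟩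
      · exact hd.continuousAt.comp (f := fun y : ℂ => fun _ : Unit => y) (by fun_prop)
      · refine (hU.preimage (by fun_prop)).inter (isOpen_ne_fun ?_ continuous_const)
        exact ((monicPoly (T x)).continuous.comp continuous_snd).mul (by fun_prop)
      · simp only [div_eq_mul_inv]
        refine DifferentiableOn.mul ?_ (DifferentiableOn.inv ?_ fun w hw => hw.2)
        · exact hG.comp (f := fun w : (Unit → ℂ) × ℂ => (x, w.2)) (by fun_prop) fun w hw => hw.1
        · refine DifferentiableOn.mul ?_ (by fun_prop)
          exact ((monicPoly (T x)).differentiable.comp differentiable_snd).differentiableOn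
    have hO : (fun y => (2 * Real.pi * Complex.I : ℂ)⁻¹ * K y) =O[𝓝 α] fun _ => (1 : ℂ) :=
      (hK.const_mul _).tendsto.isBigO_one ℂ
    have hO' := hO.mul (isBigO_refl (fun y => (monicPoly (T x)).eval y) (𝓝 α))
    simp only [one_mul] at hO'
    refine hO'.congr' ?_ EventuallyEq.rfl
    filter_upwards [isOpen_ball.mem_nhds hαa] with y hy
    exact (hid y hy).symm

end LocalRemainder

/-! ### The remainder as a function of the parameters -/

section Remainder

open Polynomial Filter Topology Asymptotics

variable {L : FirstOrder.Language.{u, v}} [L.Structure ℝ] {m p : ℕ}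

/-- The points `(x', t)` such that all the roots `y` of `P(t, ·)` satisfy `(x', y) ∈ Ω'`. -/
def remainderDomain (Ω' : Set (Fin (m + 1) → ℂ)) (p : ℕ) : Set (Fin m ⊕ Fin p → ℂ) :=
  {w | ∀ y, (monicPoly (w ∘ Sum.inr)).eval y = 0 →
    (Fin.snoc (α := fun _ => ℂ) (w ∘ Sum.inl) y : Fin (m + 1) → ℂ) ∈ Ω'}

open Classical in
/-- The remainder of `G(x', ·)` modulo `P(t, ·)` as a function of `(x', t)`; it is `0` where there
is none. -/
noncomputable def remainder (G : (Fin (m + 1) → ℂ) → ℂ) (p : ℕ) (w : Fin m ⊕ Fin p → ℂ) :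
    Fin p → ℂ :=
  if h : ∃ k, IsRemainder (fun y => G (Fin.snoc (α := fun _ => ℂ) (w ∘ Sum.inl) y))
    (w ∘ Sum.inr) k then h.choose else 0

theorem remainder_eq {G : (Fin (m + 1) → ℂ) → ℂ} {w : Fin m ⊕ Fin p → ℂ} {k : Fin p → ℂ}
    (h : IsRemainder (fun y => G (Fin.snoc (α := fun _ => ℂ) (w ∘ Sum.inl) y))
      (w ∘ Sum.inr) k) : remainder G p w = k := by
  have hex : ∃ k, IsRemainder (fun y => G (Fin.snoc (α := fun _ => ℂ) (w ∘ Sum.inl) y))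
    (w ∘ Sum.inr) k := ⟨k, h⟩
  rw [remainder, dif_pos hex]
  exact hex.choose_spec.unique h

theorem differentiable_snoc :
    Differentiable ℂ fun w : (Fin m ⊕ Fin p → ℂ) × ℂ =>
      (Fin.snoc (α := fun _ => ℂ) (w.1 ∘ Sum.inl) w.2 : Fin (m + 1) → ℂ) := by
  rw [differentiable_pi]
  refine Fin.lastCases ?_ fun i => ?_
  · simp only [Fin.snoc_last]
    fun_prop
  · simp only [Fin.snoc_castSucc, Function.comp_apply]
    fun_prop

theorem isOpen_remainderDomain {Ω' : Set (Fin (m + 1) → ℂ)} (hΩ' : IsOpen Ω') :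
    IsOpen (remainderDomain Ω' p) := by
  rw [isOpen_iff_mem_nhds]
  intro w hw
  exact eventually_forall_root (X := Fin m ⊕ Fin p → ℂ) (T := fun w => w ∘ Sum.inr)
    (by fun_prop) (hΩ'.preimage differentiable_snoc.continuous) hw

theorem exists_local_remainder {Ω' : Set (Fin (m + 1) → ℂ)} (hΩ' : IsOpen Ω')
    {G : (Fin (m + 1) → ℂ) → ℂ} (hG : DifferentiableOn ℂ G Ω') {w₀ : Fin m ⊕ Fin p → ℂ}
    (hw₀ : w₀ ∈ remainderDomain Ω' p) :
    ∃ H : (Fin m ⊕ Fin p → ℂ) → Fin p → ℂ, (∀ j, DifferentiableAt ℂ (fun w => H w j) w₀) ∧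
      ∀ᶠ w in 𝓝 w₀, IsRemainder (fun y => G (Fin.snoc (α := fun _ => ℂ) (w ∘ Sum.inl) y))
        (w ∘ Sum.inr) (H w) :=
  exists_differentiableAt_isRemainder (T := fun w : Fin m ⊕ Fin p → ℂ => w ∘ Sum.inr)
    (by rw [differentiable_pi]; intro j; simp only [Function.comp_apply]; fun_prop)
    (hΩ'.preimage differentiable_snoc.continuous)
    (hG.comp differentiable_snoc.differentiableOn fun _ h => h) hw₀

theorem isRemainder_remainder {Ω' : Set (Fin (m + 1) → ℂ)} (hΩ' : IsOpen Ω')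
    {G : (Fin (m + 1) → ℂ) → ℂ} (hG : DifferentiableOn ℂ G Ω') {w : Fin m ⊕ Fin p → ℂ}
    (hw : w ∈ remainderDomain Ω' p) :
    IsRemainder (fun y => G (Fin.snoc (α := fun _ => ℂ) (w ∘ Sum.inl) y)) (w ∘ Sum.inr)
      (remainder G p w) := by
  obtain ⟨H, -, hH⟩ := exists_local_remainder hΩ' hG hw
  have h := hH.self_of_nhds
  rwa [remainder_eq h]

theorem differentiableOn_remainder {Ω' : Set (Fin (m + 1) → ℂ)} (hΩ' : IsOpen Ω')
    {G : (Fin (m + 1) → ℂ) → ℂ} (hG : DifferentiableOn ℂ G Ω') (j : Fin p) :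
    DifferentiableOn ℂ (fun w => remainder G p w j) (remainderDomain Ω' p) := by
  intro w₀ hw₀
  obtain ⟨H, hd, hH⟩ := exists_local_remainder hΩ' hG hw₀
  refine ((hd j).congr_of_eventuallyEq ?_).differentiableWithinAt
  filter_upwards [hH] with w hw
  rw [remainder_eq hw]

/-! ### Definability of the remainder -/

/-- `IsRemainder` written as a first-order formula; the bound and the radius in it are the norms of
complex numbers, so that all quantifiers range over `ℂ`. -/
theorem isRemainder_iff {g : ℂ → ℂ} {t h : Fin p → ℂ} :
    IsRemainder g t h ↔ ∀ a, (monicPoly t).eval a = 0 → ∃ c d : ℂ, d ≠ 0 ∧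
      ∀ y, ‖y - a‖ < ‖d‖ → ‖g y - (lowPoly h).eval y‖ ≤ ‖c * (monicPoly t).eval y‖ := by
  refine forall₂_congr fun a _ => ?_
  rw [isBigO_iff']
  simp only [Metric.eventually_nhds_iff, dist_eq_norm, norm_mul]
  constructor
  · rintro ⟨c, hc, ε, hε, h⟩
    refine ⟨c, ε, by exact_mod_cast hε.ne', fun y hy => ?_⟩
    rw [Complex.norm_of_nonneg hc.le]
    exact h (by rwa [Complex.norm_of_nonneg hε.le] at hy)
  · rintro ⟨c, d, hd, h⟩
    refine ⟨‖c‖ + 1, by positivity, ‖d‖, norm_pos_iff.mpr hd, fun y hy => (h y hy).trans ?_⟩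
    gcongr
    linarith

namespace DefinableComplexFun

variable {ι : Type*}

theorem comp_some [Finite ι] {f : (ι → ℂ) → ℂ} (hf : DefinableComplexFun L f) :
    DefinableComplexFun L (fun w : Option ι → ℂ => f (w ∘ some)) :=
  hf.comp fun i => proj (some i)

theorem eval_lowPoly (hL : IsOMinimalExpansion L) {H : (ι → ℂ) → Fin p → ℂ} {y : (ι → ℂ) → ℂ}
    (hH : ∀ j, DefinableComplexFun L fun w => H w j) (hy : DefinableComplexFun L y) :
    DefinableComplexFun L (fun w => (lowPoly (H w)).eval (y w)) := by
  simp only [_root_.eval_lowPoly]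
  exact sum hL _ fun j => (hH j).mul hL (hy.pow hL _)

theorem eval_monicPoly (hL : IsOMinimalExpansion L) {T : (ι → ℂ) → Fin p → ℂ} {y : (ι → ℂ) → ℂ}
    (hT : ∀ j, DefinableComplexFun L fun w => T w j) (hy : DefinableComplexFun L y) :
    DefinableComplexFun L (fun w => (monicPoly (T w)).eval (y w)) := by
  simp only [_root_.eval_monicPoly]
  exact (hy.pow hL p).add hL (sum hL _ fun j => (hT j).mul hL (hy.pow hL _))

theorem snoc {Z : (ι → ℂ) → Fin m → ℂ} {y : (ι → ℂ) → ℂ}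
    (hZ : ∀ j, DefinableComplexFun L fun w => Z w j) (hy : DefinableComplexFun L y)
    (i : Fin (m + 1)) :
    DefinableComplexFun L
      (fun w => (Fin.snoc (α := fun _ => ℂ) (Z w) (y w) : Fin (m + 1) → ℂ) i) := by
  refine Fin.lastCases ?_ (fun i => ?_) i
  · simpa only [Fin.snoc_last]
  · simpa only [Fin.snoc_castSucc] using hZ i

end DefinableComplexFun

open DefinableComplexFun in
theorem definable_isRemainder (hL : IsOMinimalExpansion L) {ι : Type*} [Finite ι]
    {G : (Fin (m + 1) → ℂ) → ℂ} (hG : DefinableComplexFun L G) {Z : (ι → ℂ) → Fin m → ℂ}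
    {T H : (ι → ℂ) → Fin p → ℂ} (hZ : ∀ j, DefinableComplexFun L fun w => Z w j)
    (hT : ∀ j, DefinableComplexFun L fun w => T w j)
    (hH : ∀ j, DefinableComplexFun L fun w => H w j) :
    DefinableComplexSet L {w | IsRemainder
      (fun y => G (Fin.snoc (α := fun _ => ℂ) (Z w) y)) (T w) (H w)} := by
  simp only [isRemainder_iff]
  refine DefinableComplexSet.forall_coord (DefinableComplexSet.imp
    (DefinableComplexSet.eq (eval_monicPoly hL (fun j => (hT j).comp_some) (proj none))
      (const 0)) ?_)
  refine DefinableComplexSet.exists_coord (DefinableComplexSet.exists_coord ?_)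
  refine DefinableComplexSet.and (DefinableComplexSet.not
    (DefinableComplexSet.eq (proj none) (const 0))) ?_
  refine DefinableComplexSet.forall_coord (DefinableComplexSet.imp
    (DefinableComplexSet.norm_lt hL (sub hL (proj none) (proj (some (some (some none)))))
      (proj (some none)))
    (DefinableComplexSet.norm_le hL (sub hL (hG.comp (F := fun w => Fin.snoc (α := fun _ => ℂ)
      (Z (((w ∘ some) ∘ some) ∘ some ∘ some)) (w none)) (snoc ?_ (proj none)))
      (eval_lowPoly hL ?_ (proj none)))
      (mul hL (proj (some (some none))) (eval_monicPoly hL ?_ (proj none)))))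
  · exact fun j => (hZ j).comp_some.comp_some.comp_some.comp_some
  · exact fun j => (hH j).comp_some.comp_some.comp_some.comp_some
  · exact fun j => (hT j).comp_some.comp_some.comp_some.comp_some

theorem definable_remainder (hL : IsOMinimalExpansion L) {G : (Fin (m + 1) → ℂ) → ℂ}
    (hG : DefinableComplexFun L G) (j : Fin p) :
    DefinableComplexFun L (fun w : Fin m ⊕ Fin p → ℂ => remainder G p w j) := by
  have hex : DefinableComplexSet L {w : Fin m ⊕ Fin p → ℂ | ∃ k, IsRemainder
      (fun y => G (Fin.snoc (α := fun _ => ℂ) (w ∘ Sum.inl) y)) (w ∘ Sum.inr) k} :=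
    DefinableComplexSet.exists_vector (definable_isRemainder hL hG
      (fun i => .proj (Sum.inl (Sum.inl i))) (fun i => .proj (Sum.inl (Sum.inr i)))
      fun i => .proj (Sum.inr i))
  have hval : DefinableComplexSet L {w : Option (Fin m ⊕ Fin p) → ℂ | ∃ k : Fin p → ℂ,
      IsRemainder (fun y => G (Fin.snoc (α := fun _ => ℂ) ((w ∘ some) ∘ Sum.inl) y))
        ((w ∘ some) ∘ Sum.inr) k ∧ k j = w none} :=
    DefinableComplexSet.exists_vector (P := fun (w : Option (Fin m ⊕ Fin p) → ℂ) k =>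
      IsRemainder (fun y => G (Fin.snoc (α := fun _ => ℂ) ((w ∘ some) ∘ Sum.inl) y))
        ((w ∘ some) ∘ Sum.inr) k ∧ k j = w none) <|
      DefinableComplexSet.and (definable_isRemainder hL hG
        (fun i => .proj (Sum.inl (some (Sum.inl i)))) (fun i => .proj (Sum.inl (some (Sum.inr i))))
        fun i => .proj (Sum.inr i))
      (DefinableComplexSet.eq (.proj (Sum.inr j)) (.proj (Sum.inl none)))
  refine DefinableComplexFun.of_graph ?_
  refine cast (congrArg _ ?_) (hval.or ((hex.preimage
    (F := fun w : Option (Fin m ⊕ Fin p) → ℂ => w ∘ some) fun i => .proj (some i)).not.and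
      (DefinableComplexSet.eq (.const 0) (.proj none))))
  ext w
  by_cases h : ∃ k, IsRemainder
    (fun y => G (Fin.snoc (α := fun _ => ℂ) ((w ∘ some) ∘ Sum.inl) y)) ((w ∘ some) ∘ Sum.inr) k
  · constructor
    · rintro (⟨k, hk, hkj⟩ | hn)
      · exact (congrFun (remainder_eq hk) j).trans hkj
      · exact absurd h hn.1
    · intro hw
      obtain ⟨k, hk⟩ := h
      exact Or.inl ⟨k, hk, (congrFun (remainder_eq hk) j).symm.trans hw⟩
  · have h0 : remainder G p (w ∘ some) j = 0 := by
      rw [remainder, dif_neg h]; rfl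
    constructor
    · rintro (⟨k, hk, -⟩ | hn)
      · exact absurd ⟨k, hk⟩ h
      · exact h0.trans hn.2
    · intro hw
      exact Or.inr ⟨h, h0.symm.trans hw⟩

theorem definable_remainderDomain (hL : IsOMinimalExpansion L) {Ω' : Set (Fin (m + 1) → ℂ)}
    (hΩ' : DefinableComplexSet L Ω') : DefinableComplexSet L (remainderDomain Ω' p) :=
  DefinableComplexSet.forall_coord <| DefinableComplexSet.imp
    (DefinableComplexSet.eq (DefinableComplexFun.eval_monicPoly hL
      (fun j => .proj (some (Sum.inr j))) (.proj none)) (.const 0))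
    (hΩ'.preimage (DefinableComplexFun.snoc (fun j => .proj (some (Sum.inl j))) (.proj none)))

end Remainder

/-! ### Real parts of holomorphic functions -/

section RealPart

variable {L : FirstOrder.Language.{u, v}} [L.Structure ℝ] {ι : Type*} [Fintype ι]

/-- `w ↦ conj F(conj w)` is holomorphic when `F` is: its real derivative is complex linear. -/
theorem DifferentiableAt.conj_comp_conj {F : (ι → ℂ) → ℂ} {z : ι → ℂ}
    (hF : DifferentiableAt ℂ F (star z)) :
    DifferentiableAt ℂ (fun w => (starRingEnd ℂ) (F (star w))) z := by
  let F' := fderiv ℂ F (star z)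
  let g : (ι → ℂ) →ₗ[ℂ] ℂ :=
    { toFun := fun v => (starRingEnd ℂ) (F' (star v))
      map_add' := fun v w => by simp
      map_smul' := fun c v => by simp }
  let S : (ι → ℂ) →L[ℝ] (ι → ℂ) := (starL' ℝ : (ι → ℂ) ≃L[ℝ] (ι → ℂ))
  have hS : HasFDerivAt (fun w : ι → ℂ => star w) S z := S.hasFDerivAt
  have h := (Complex.conjCLE : ℂ ≃L[ℝ] ℂ).hasFDerivAt.comp z
    ((hF.hasFDerivAt.restrictScalars ℝ).comp z hS)
  have h' := hasFDerivAt_of_restrictScalars (𝕜 := ℝ)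
    (f' := LinearMap.toContinuousLinearMap g) h rfl
  exact h'.differentiableAt

/-- The real part of a definable holomorphic function is `ℂ`-definable on the real points: it
extends to `z ↦ (F(z) + conj F(conj z)) / 2`. -/
theorem cDefinableOn_re (hL : IsOMinimalExpansion L) {Ω : Set (ι → ℝ)} {Z : Set (ι → ℂ)}
    (hZ : IsOpen Z) (hZdef : DefinableComplexSet L Z)
    (htrace : ∀ x : ι → ℝ, (fun k => (x k : ℂ)) ∈ Z ↔ x ∈ Ω) {F : (ι → ℂ) → ℂ}
    (hF : DifferentiableOn ℂ F Z) (hFdef : DefinableComplexFun L F) :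
    CDefinableOn L Ω (fun x => (F fun k => (x k : ℂ)).re) := by
  have hstar : ∀ i, DefinableComplexFun L fun z : ι → ℂ => star z i := fun i =>
    (DefinableComplexFun.proj i).conj hL
  have hreal : ∀ x : ι → ℝ, star (fun k => (x k : ℂ)) = fun k => (x k : ℂ) := fun x => by
    ext k; simp
  have hdef : DefinableComplexSet L {z | z ∈ Z ∧ star z ∈ Z} :=
    DefinableComplexSet.and hZdef (hZdef.preimage hstar)
  refine ⟨{z | z ∈ Z ∧ star z ∈ Z}, fun z => (1 / 2) * (F z + (starRingEnd ℂ) (F (star z))),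
    hZ.inter (hZ.preimage continuous_star), hdef, fun x => ?_, ?_, ?_, fun x hx => ?_⟩
  · rw [Set.mem_ofPred_eq, hreal, and_self, htrace]
  · intro z hz
    exact (((hF.differentiableAt (hZ.mem_nhds hz.1)).add
      (hF.differentiableAt (hZ.mem_nhds hz.2)).conj_comp_conj).const_mul _).differentiableWithinAt
  · exact ((DefinableComplexFun.const _).mul hL
      (hFdef.add hL ((hFdef.comp hstar).conj hL))).restrict hdef
  · dsimp only
    rw [hreal, Complex.add_conj]
    simp

end RealPart

/-! ### The quotient -/

/-- `projInit` is a surjective linear map. -/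
theorem isOpenMap_projInit {m p : ℕ} :
    IsOpenMap (projInit : (Fin (m + 1) ⊕ Fin p → ℝ) → Fin m ⊕ Fin p → ℝ) := by
  let f := LinearMap.funLeft ℝ ℝ (Sum.map Fin.castSucc id : Fin m ⊕ Fin p → Fin (m + 1) ⊕ Fin p)
  have hf : Function.Surjective f := LinearMap.funLeft_surjective_of_injective ℝ ℝ _
    (Sum.map_injective.mpr ⟨Fin.castSucc_injective m, Function.injective_id⟩)
  exact f.isOpenMap_of_finiteDimensional hf

section MulLinear

variable {L : FirstOrder.Language.{u, v}} [L.Structure ℝ] {m p : ℕ}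

/-- The point `(x', coefficients of (Y - x_n) P(t, Y))` attached to `(x, t)`. -/
noncomputable def adjoinRoot (w : Fin (m + 1) ⊕ Fin p → ℂ) : Fin m ⊕ Fin (p + 1) → ℂ :=
  Sum.elim (fun i => w (Sum.inl i.castSucc))
    (mulLinear (fun j => w (Sum.inr j)) (w (Sum.inl (Fin.last m))))

theorem differentiable_adjoinRoot :
    Differentiable ℂ (adjoinRoot : (Fin (m + 1) ⊕ Fin p → ℂ) → Fin m ⊕ Fin (p + 1) → ℂ) := by
  rw [differentiable_pi]
  rintro (i | j)
  · simp only [adjoinRoot, Sum.elim_inl]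
    fun_prop
  · simp only [adjoinRoot, Sum.elim_inr, mulLinear]
    refine Differentiable.sub ?_ (Differentiable.mul (by fun_prop) ?_)
    · refine Fin.lastCases ?_ (fun j => ?_) j
      · simp only [Fin.snoc_last]; fun_prop
      · simp only [Fin.snoc_castSucc]; fun_prop
    · refine Fin.cases ?_ (fun j => ?_) j
      · simp only [Fin.cons_zero]; fun_prop
      · simp only [Fin.cons_succ]; fun_prop

theorem definable_adjoinRoot (hL : IsOMinimalExpansion L) (k : Fin m ⊕ Fin (p + 1)) :
    DefinableComplexFun L (fun w : Fin (m + 1) ⊕ Fin p → ℂ => adjoinRoot w k) := by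
  rcases k with i | j
  · exact .proj _
  · simp only [adjoinRoot, Sum.elim_inr, mulLinear]
    refine DefinableComplexFun.sub hL ?_ (DefinableComplexFun.mul hL (.proj _) ?_)
    · refine Fin.lastCases ?_ (fun j => ?_) j
      · simp only [Fin.snoc_last]; exact .const 0
      · simp only [Fin.snoc_castSucc]; exact .proj _
    · refine Fin.cases ?_ (fun j => ?_) j
      · simp only [Fin.cons_zero]; exact .const 1
      · simp only [Fin.cons_succ]; exact .proj _

/-- The points `(x, t)` with `x ∈ Ω'` and `(x', t) ∈ remainderDomain Ω' p`. -/
def divisionDomain (Ω' : Set (Fin (m + 1) → ℂ)) (p : ℕ) : Set (Fin (m + 1) ⊕ Fin p → ℂ) :=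
  {w | w ∘ Sum.inl ∈ Ω' ∧ w ∘ Sum.map Fin.castSucc id ∈ remainderDomain Ω' p}

theorem snoc_castSucc_inl (w : Fin (m + 1) ⊕ Fin p → ℂ) :
    (Fin.snoc (α := fun _ => ℂ) (fun i : Fin m => w (Sum.inl i.castSucc))
      (w (Sum.inl (Fin.last m))) : Fin (m + 1) → ℂ) = w ∘ Sum.inl :=
  Fin.snoc_init_self (α := fun _ => ℂ) (w ∘ Sum.inl)

theorem adjoinRoot_mem {Ω' : Set (Fin (m + 1) → ℂ)} {w : Fin (m + 1) ⊕ Fin p → ℂ}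
    (hw : w ∈ divisionDomain Ω' p) : adjoinRoot w ∈ remainderDomain Ω' (p + 1) := by
  intro y hy
  have hy' : (y - w (Sum.inl (Fin.last m))) *
      (monicPoly fun j => w (Sum.inr j)).eval y = 0 := by
    rw [← eval_monicPoly_mulLinear]; exact hy
  rcases mul_eq_zero.mp hy' with h | h
  · rw [sub_eq_zero.mp h]
    have := hw.1
    rwa [← snoc_castSucc_inl] at this
  · exact hw.2 y h

theorem isOpen_divisionDomain {Ω' : Set (Fin (m + 1) → ℂ)} (hΩ' : IsOpen Ω') :
    IsOpen (divisionDomain Ω' p) :=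
  (hΩ'.preimage (by fun_prop)).inter ((isOpen_remainderDomain hΩ').preimage (by fun_prop))

theorem definable_divisionDomain (hL : IsOMinimalExpansion L) {Ω' : Set (Fin (m + 1) → ℂ)}
    (hΩ' : DefinableComplexSet L Ω') : DefinableComplexSet L (divisionDomain Ω' p) :=
  DefinableComplexSet.and (hΩ'.preimage fun i => .proj (Sum.inl i))
    ((definable_remainderDomain hL hΩ').preimage fun i => .proj (Sum.map Fin.castSucc id i))

/-- The Weierstrass division of `G` by the generic monic polynomial, on the complex domain. -/
theorem division_eq {Ω' : Set (Fin (m + 1) → ℂ)} (hΩ' : IsOpen Ω')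
    {G : (Fin (m + 1) → ℂ) → ℂ} (hG : DifferentiableOn ℂ G Ω') {w : Fin (m + 1) ⊕ Fin p → ℂ}
    (hw : w ∈ divisionDomain Ω' p) :
    G (w ∘ Sum.inl) = remainder G (p + 1) (adjoinRoot w) 0 *
        (monicPoly (w ∘ Sum.inr)).eval (w (Sum.inl (Fin.last m))) +
      (lowPoly (remainder G p (w ∘ Sum.map Fin.castSucc id))).eval (w (Sum.inl (Fin.last m))) := by
  have h1 := isRemainder_remainder hΩ' hG hw.2
  have h2 := isRemainder_remainder hΩ' hG (adjoinRoot_mem hw)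
  have h3 := h1.division (s := w (Sum.inl (Fin.last m))) h2
  rw [← snoc_castSucc_inl]
  exact h3

end MulLinear

/-! ### The division theorem -/

/-- Coordinates on `ℝ^n`, `n = m + 1`, are `x = (x', x_n)`, with `x_n = x (Fin.last m)`; a point
`(x, t)` of `ℝ^n × ℝ^p` is `Sum.elim x t`. -/
theorem theorem4p1 (L : FirstOrder.Language.{u, v}) [L.Structure ℝ] (hL : IsOMinimalExpansion L)
    (m p : ℕ) (Ω : Set (Fin (m + 1) → ℝ)) (hΩ : IsOpen Ω) (hΩdef : DefinableSet L Ω)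
    (g : (Fin (m + 1) → ℝ) → ℝ) (hg : CDefinableOn L Ω g) :
    ∃ W : Set (Fin (m + 1) ⊕ Fin p → ℝ),
      IsOpen W ∧ DefinableSet L W ∧
      projBase '' W = Ω ∧
      (∀ x ∈ Ω, ∀ b : Fin p → ℝ, (∀ j, Function.update x (Fin.last m) (b j) ∈ Ω) →
        Sum.elim x (signedEsymm b) ∈ W) ∧
      ∃ (q : (Fin (m + 1) ⊕ Fin p → ℝ) → ℝ) (h : Fin p → (Fin m ⊕ Fin p → ℝ) → ℝ),
        CDefinableOn L W q ∧
        (∀ j, CDefinableOn L (projInit '' W) (h j)) ∧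
        ∀ (x : Fin (m + 1) → ℝ) (t : Fin p → ℝ), Sum.elim x t ∈ W →
          g x = q (Sum.elim x t) * genericPoly t (x (Fin.last m)) +
            ∑ j : Fin p, h j (projInit (Sum.elim x t)) * x (Fin.last m) ^ (p - (j.val + 1)) := by
  classical
  obtain ⟨Ω', F, hΩ', hΩ'def, htrace, hF, hFdef, hFg⟩ := hg
  let G : (Fin (m + 1) → ℂ) → ℂ := fun z => if z ∈ Ω' then F z else 0
  have hGdef : DefinableComplexFun L G := hFdef.extend hΩ'def
  have hGF : ∀ z ∈ Ω', G z = F z := fun z hz => if_pos hz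
  have hG : DifferentiableOn ℂ G Ω' := hF.congr hGF
  let W : Set (Fin (m + 1) ⊕ Fin p → ℝ) := {w | (fun k => (w k : ℂ)) ∈ divisionDomain Ω' p}
  have hWopen : IsOpen W := (isOpen_divisionDomain hΩ').preimage (by fun_prop)
  have hWdef : DefinableSet L W := (definable_divisionDomain hL hΩ'def).real_trace
  have hWbase : ∀ w ∈ W, projBase w ∈ Ω := fun w hw => (htrace (projBase w)).mp hw.1
  have hWroots : ∀ x ∈ Ω, ∀ b : Fin p → ℝ, (∀ j, Function.update x (Fin.last m) (b j) ∈ Ω) →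
      Sum.elim x (signedEsymm b) ∈ W := by
    intro x hx b hb
    refine ⟨(htrace x).mpr hx, fun y hy => ?_⟩
    have hy' : (monicPoly fun j => (signedEsymm b j : ℂ)).eval y = 0 := hy
    rw [eval_monicPoly_signedEsymm, Finset.prod_eq_zero_iff] at hy'
    obtain ⟨j, -, hj⟩ := hy'
    convert (htrace _).mpr (hb j) using 1
    funext i
    refine Fin.lastCases ?_ (fun i => ?_) i
    · simp [sub_eq_zero.mp hj]
    · simp [(Fin.castSucc_lt_last i).ne]
  refine ⟨W, hWopen, hWdef, ?_, hWroots,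
    fun w => (remainder G (p + 1) (adjoinRoot fun k => (w k : ℂ)) 0).re,
    fun j w => (remainder G p (fun k => (w k : ℂ)) j).re, ?_, fun j => ?_, ?_⟩
  · refine Set.Subset.antisymm (Set.image_subset_iff.mpr hWbase) fun x hx => ?_
    refine ⟨_, hWroots x hx (fun _ => x (Fin.last m)) fun j => ?_, rfl⟩
    rwa [Function.update_eq_self]
  · exact cDefinableOn_re hL (isOpen_divisionDomain hΩ') (definable_divisionDomain hL hΩ'def)
      (fun _ => Iff.rfl) ((differentiableOn_remainder hΩ' hG 0).comp
        differentiable_adjoinRoot.differentiableOn fun _ => adjoinRoot_mem)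
      ((definable_remainder hL hGdef 0).comp (definable_adjoinRoot hL))
  · -- The real trace of `remainderDomain Ω' p` may exceed `π(W)`: it is cut down to the points with
    -- real part in `π(W)`.
    have hopen : IsOpen {z : Fin m ⊕ Fin p → ℂ | (fun k => (z k).re) ∈ projInit '' W} :=
      (isOpenMap_projInit W hWopen).preimage (by fun_prop)
    have hdef : DefinableComplexSet L
        {z : Fin m ⊕ Fin p → ℂ | (fun k => (z k).re) ∈ projInit '' W} :=
      (Set.Definable.image_comp hWdef (Sum.map Fin.castSucc id)).preimage_comp Sum.inl
    refine cDefinableOn_re hL ((isOpen_remainderDomain hΩ').inter hopen)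
      ((definable_remainderDomain hL hΩ'def).and hdef) (fun x => ?_)
      ((differentiableOn_remainder hΩ' hG j).mono Set.inter_subset_left)
      (definable_remainder hL hGdef j)
    constructor
    · exact fun hx => hx.2
    · rintro ⟨w, hw, rfl⟩
      exact ⟨hw.2, w, hw, rfl⟩
  · intro x t hxt
    have hx : x ∈ Ω := hWbase _ hxt
    have h := congrArg Complex.re (division_eq hΩ' hG hxt)
    have hGx : G ((fun k => ((Sum.elim x t k : ℝ) : ℂ)) ∘ Sum.inl) = (g x : ℂ) :=
      (hGF _ hxt.1).trans (hFg x hx)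
    have hP : (monicPoly ((fun k => ((Sum.elim x t k : ℝ) : ℂ)) ∘ Sum.inr)).eval
        ((x (Fin.last m) : ℝ) : ℂ) = ((genericPoly t (x (Fin.last m)) : ℝ) : ℂ) := by
      rw [eval_monicPoly, genericPoly]
      push_cast
      rfl
    rw [hGx, Complex.ofReal_re, Sum.elim_inl, hP, Complex.add_re, Complex.re_mul_ofReal,
      eval_lowPoly, Complex.re_sum] at h
    rw [h]
    congr 1
    refine Finset.sum_congr rfl fun j _ => ?_
    rw [← Complex.ofReal_pow, Complex.re_mul_ofReal]
    rfl
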